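/- Let $SG_{2,3}(0)$ be the triangle graph $K_3$, drawn as an equilateral triangle, and let $SG_{2,3}(n+1)$ be obtained from six copies of $SG_{2,3}(n)$, arranged as the upward-pointing triangles of three layers (with 1, 2 and 3 copies) inside a triangle of three times the side length, where outmost (corner) vertices of different copies at the same position are identified. Let $v(n)$ be the number of vertices of $SG_{2,3}(n)$. Let $f(n)$ be the number of connected spanning subgraphs of $SG_{2,3}(n)$ (subgraphs with all the vertices and any subset of the edges), let $g(n)$ be the number of its spanning subgraphs with exactly two connected components such that the topmost vertex lies in one of them and the two other outmost vertices lie in the other, and let $h(n)$ be the number of its spanning subgraphs with exactly three connected components, each containing exactly one of the three outmost vertices. Put $\alpha(n)=f(n)/g(n)$, $\beta(n)=g(n)/h(n)$ and $$P(m)=142+18\frac{\alpha(m)}{\beta(m)}+78\alpha(m)+3\frac{\alpha(m)^2}{\beta(m)}+15\alpha(m)^2+\alpha(m)^3,$$ $$Q(m)=171+77\frac{\alpha(m)}{\beta(m)}+2\frac{\alpha(m)^2}{\beta(m)^2}+89\alpha(m)+18\frac{\alpha(m)^2}{\beta(m)}+16\alpha(m)^2+\frac{\alpha(m)^3}{\beta(m)}+\alpha(m)^3.$$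 Then the asymptotic growth constant $$z_{SG_{2,3}}=\lim_{n\to\infty}\frac{\ln f(n)}{v(n)}$$ exists and $z_{SG_{2,3}}=1.3972789680\ldots$, that is, $1.3972789680\le z_{SG_{2,3}}<1.3972789681$. Moreover, for every positive integer $m$, $$\frac{2\ln f(m)+3\ln g(m)}{7\cdot 6^m}+\frac{2\ln 196+3\ln 420}{35\cdot 6^m}\le z_{SG_{2,3}}\le\frac{2\ln f(m)+3\ln g(m)}{7\cdot 6^m}+\frac{2\ln P(m)+3\ln Q(m)}{35\cdot 6^m}.$$ -/

import Mathlib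

/-- Number of connected spanning subgraphs of a graph `G`: a spanning subgraph is a graph on the
same vertex set all of whose edges are edges of `G`. -/
noncomputable def numConnectedSpanningSubgraphs {V : Type*} (G : SimpleGraph V) : ℕ :=
  Set.ncard {H : SimpleGraph V | H ≤ G ∧ H.Connected}

namespace SG23

/-- The three corners of the unit triangle with lower left corner `c`. A pair `(x, y)` stands for
the point `x • (1, 0) + y • (1 / 2, √3 / 2)` of the triangular lattice in the plane. -/
def triangle (c : ℕ × ℕ) : Finset (ℕ × ℕ) :=
  {(c.1, c.2), (c.1 + 1, c.2), (c.1, c.2 + 1)}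

/-- The positions of the six triangles of a big triangle with three layers. -/
def offsets : Finset (ℕ × ℕ) :=
  {(0, 0), (1, 0), (2, 0), (0, 1), (1, 1), (0, 2)}

/-- Lower left corners of the unit triangles that make up the stage `n` gasket (whose side length
is `3 ^ n`). Stage `0` is one triangle; stage `n + 1` consists of six translates of stage `n`,
arranged in three layers. -/
def cells : ℕ → Finset (ℕ × ℕ)
  | 0 => {(0, 0)}
  | n + 1 => (offsets ×ˢ cells n).image
      fun p => (3 ^ n * p.1.1 + p.2.1, 3 ^ n * p.1.2 + p.2.2)

/-- Vertices of the stage `n` gasket. -/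
def vertices (n : ℕ) : Finset (ℕ × ℕ) :=
  (cells n).biUnion triangle

/-- The gasket `SG_{2,3}(n)`: the edges are the sides of the unit triangles. -/
def graph (n : ℕ) : SimpleGraph (vertices n) where
  Adj u v := u ≠ v ∧ ∃ c ∈ cells n, (u : ℕ × ℕ) ∈ triangle c ∧ (v : ℕ × ℕ) ∈ triangle c
  symm := ⟨fun _ _ h => ⟨h.1.symm, h.2.imp fun _ hc => ⟨hc.1, hc.2.2, hc.2.1⟩⟩⟩
  loopless := ⟨fun _ h => h.1 rfl⟩

theorem zero_mem_cells (n : ℕ) : ((0, 0) : ℕ × ℕ) ∈ cells n := by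
  induction n with
  | zero => simp [cells]
  | succ n ih =>
    exact Finset.mem_image.2 ⟨((0, 0), (0, 0)), Finset.mem_product.2 ⟨by simp [offsets], ih⟩, rfl⟩

theorem right_mem_cells (n : ℕ) : ((3 ^ n - 1, 0) : ℕ × ℕ) ∈ cells n := by
  induction n with
  | zero => simp [cells]
  | succ n ih =>
    refine Finset.mem_image.2 ⟨((2, 0), (3 ^ n - 1, 0)),
      Finset.mem_product.2 ⟨by simp [offsets], ih⟩, ?_⟩
    have : 0 < 3 ^ n := by positivity
    refine Prod.ext ?_ (by simp)
    show 3 ^ n * 2 + (3 ^ n - 1) = 3 ^ (n + 1) - 1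
    rw [pow_succ]; omega

theorem top_mem_cells (n : ℕ) : ((0, 3 ^ n - 1) : ℕ × ℕ) ∈ cells n := by
  induction n with
  | zero => simp [cells]
  | succ n ih =>
    refine Finset.mem_image.2 ⟨((0, 2), (0, 3 ^ n - 1)),
      Finset.mem_product.2 ⟨by simp [offsets], ih⟩, ?_⟩
    have : 0 < 3 ^ n := by positivity
    refine Prod.ext (by simp) ?_
    show 3 ^ n * 2 + (3 ^ n - 1) = 3 ^ (n + 1) - 1
    rw [pow_succ]; omega

/-- The lower left outmost vertex. -/
def left (n : ℕ) : vertices n :=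
  ⟨(0, 0), Finset.mem_biUnion.2 ⟨_, zero_mem_cells n, by simp [triangle]⟩⟩

/-- The lower right outmost vertex. -/
def right (n : ℕ) : vertices n :=
  ⟨(3 ^ n, 0), Finset.mem_biUnion.2 ⟨_, right_mem_cells n, by
    have : 3 ^ n = 3 ^ n - 1 + 1 := (Nat.sub_add_cancel (Nat.one_le_pow _ _ (by norm_num))).symm
    simp [triangle, ← this]⟩⟩

/-- The topmost vertex. -/
def top (n : ℕ) : vertices n :=
  ⟨(0, 3 ^ n), Finset.mem_biUnion.2 ⟨_, top_mem_cells n, by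
    have : 3 ^ n = 3 ^ n - 1 + 1 := (Nat.sub_add_cancel (Nat.one_le_pow _ _ (by norm_num))).symm
    simp [triangle, ← this]⟩⟩

/-- Number of connected spanning subgraphs of the stage `n` gasket. -/
noncomputable def f (n : ℕ) : ℕ := numConnectedSpanningSubgraphs (graph n)

/-- Number of spanning subgraphs of the stage `n` gasket with exactly two connected components,
one containing the topmost vertex and the other one the two other outmost vertices. -/
noncomputable def g (n : ℕ) : ℕ :=
  Set.ncard {H : SimpleGraph (vertices n) | H ≤ graph n ∧ Nat.card H.ConnectedComponent = 2 ∧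
    H.Reachable (left n) (right n) ∧ ¬ H.Reachable (top n) (left n)}

/-- Number of spanning subgraphs of the stage `n` gasket with exactly three connected components,
each containing one of the three outmost vertices. -/
noncomputable def h (n : ℕ) : ℕ :=
  Set.ncard {H : SimpleGraph (vertices n) | H ≤ graph n ∧ Nat.card H.ConnectedComponent = 3 ∧
    ¬ H.Reachable (left n) (right n) ∧ ¬ H.Reachable (top n) (left n) ∧
    ¬ H.Reachable (top n) (right n)}

noncomputable def α (n : ℕ) : ℝ := (f n : ℝ) / (g n : ℝ)

noncomputable def β (n : ℕ) : ℝ := (g n : ℝ) / (h n : ℝ)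

noncomputable def P (m : ℕ) : ℝ :=
  142 + 18 * (α m / β m) + 78 * α m + 3 * (α m ^ 2 / β m) + 15 * α m ^ 2 + α m ^ 3

noncomputable def Q (m : ℕ) : ℝ :=
  171 + 77 * (α m / β m) + 2 * (α m ^ 2 / β m ^ 2) + 89 * α m + 18 * (α m ^ 2 / β m)
    + 16 * α m ^ 2 + α m ^ 3 / β m + α m ^ 3

end SG23

/-! A spanning subgraph of a glued graph is an independent choice of spanning subgraphs of the
copies. How it connects the glued corners depends only on the partition that each copy induces on
its own three corners. If every vertex is to reach an outmost vertex, every vertex of a copy must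
reach a corner of that copy, so five states per copy suffice (`CornerGluing.stateCount_glue`).
Summing over the 5 ^ 6 assignments of states by a verified enumeration (`sum_leaves`, `sum_gluesTo`)
gives recursions for `f`, `g`, `h`, homogeneous of degree 6.

In terms of `α` and `ρ = α / β` these read f(n+1) = f³ g³ P and g(n+1) = f² g⁴ Q. The row vector (2,
3) is a left eigenvector of the exponent matrix ((3, 3), (2, 4)) for the eigenvalue 6. Hence 2 ln f
+ 3 ln g, divided by 7 · 6 ^ n, is a series with terms `increment n / (42 * 6 ^ n)` (`weight_succ`).
If all increments from n on lie between `limitIncrement` and `increment n`, the geometric tail lies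
between these two numbers divided by 35 · 6 ^ n; these are the claimed bounds.

For the lower bound, P and Q are monotone in (α, ρ), α > 0 and ρ ≥ 3, and at (0, 3) their values are
196 and 420. For the upper bound the increments must decrease, which follows once α and ρ do. For ρ
this rests on the invariant 3 ≤ ρ ≤ 4, α ≤ 15 (ρ - 3), valid from n = 2 on (`ρ_bounds`). Finally 5
v(n) = 7 · 6 ^ n + 8 and ln α(n) = O(n), so ln f(n) / v(n) has the same limit as the weight. The
digits come from the two bounds at m = 9, evaluated by interval arithmetic. -/

/-! ### Gluing graphs along corners -/

/-- The combinatorial data of a graph `W` assembled from copies of `V`, indexed by `ι`, that are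
glued along corners: `c` lists the corners of `V`, `p` the images of the corners in `W`, and
`t i a` is the index of the image of corner `a` of copy `i`. -/
structure CornerGluing {V W ι κ τ : Type*} (e : ι → V → W) (c : κ → V) (p : τ → W)
    (t : ι → κ → τ) : Prop where
  inj : ∀ i, Function.Injective (e i)
  corner : ∀ i a, e i (c a) = p (t i a)
  meet : ∀ {i j u v}, i ≠ j → e i u = e j v → ∃ a, u = c a
  meet_unique : ∀ {i j u v u' v'}, i ≠ j → e i u = e j v → e i u' = e j v' → u = u'
  p_inj : Function.Injective p
  t_surj : ∀ q, ∃ i a, t i a = q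
  cover : ∀ w, ∃ i u, e i u = w

namespace CornerGluing

variable {V W ι κ τ : Type*} {e : ι → V → W} {c : κ → V} {p : τ → W} {t : ι → κ → τ}

/-- The union of the images of the graphs `H i` under the maps `e i`. -/
def glue (e : ι → V → W) (H : ι → SimpleGraph V) : SimpleGraph W := ⨆ i, (H i).map (e i)

theorem glue_adj (hG : CornerGluing e c p t) (H : ι → SimpleGraph V) {x y : W} :
    (glue e H).Adj x y ↔ ∃ i u v, (H i).Adj u v ∧ e i u = x ∧ e i v = y := by
  simp only [glue, SimpleGraph.iSup_adj, SimpleGraph.map_adj']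
  constructor
  · rintro ⟨i, -, u, v, h⟩
    exact ⟨i, u, v, h⟩
  · rintro ⟨i, u, v, h, rfl, rfl⟩
    exact ⟨i, fun h' => h.ne (hG.inj i h'), u, v, h, rfl, rfl⟩

/-- Distinct copies share at most one vertex, hence no edge, so no copy acquires an edge from
another. This makes `glue e` injective and the choices in the copies independent. -/
theorem comap_glue (hG : CornerGluing e c p t) (H : ι → SimpleGraph V) (i : ι) :
    (glue e H).comap (e i) = H i := by
  ext u v
  rw [SimpleGraph.comap_adj, hG.glue_adj]
  constructor
  · rintro ⟨j, u', v', h, hu, hv⟩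
    by_cases hij : i = j
    · subst hij
      rwa [← hG.inj _ hu, ← hG.inj _ hv]
    · exact absurd (hG.meet_unique (Ne.symm hij) hu hv) h.ne
  · intro h
    exact ⟨i, u, v, h, rfl, rfl⟩

/-- The relation between the indices of the glued corners that the reachability relations between
the corners of the copies induce. -/
def cornerRel (c : κ → V) (t : ι → κ → τ) (H : ι → SimpleGraph V) (x y : τ) : Prop :=
  ∃ i a b, t i a = x ∧ t i b = y ∧ (H i).Reachable (c a) (c b)

theorem reachable_map (hG : CornerGluing e c p t) (H : ι → SimpleGraph V) {i : ι} {u v : V}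
    (h : (H i).Reachable u v) : (glue e H).Reachable (e i u) (e i v) := by
  rw [SimpleGraph.reachable_iff_reflTransGen] at h
  induction h with
  | refl => exact SimpleGraph.Reachable.refl _
  | tail _ h ih => exact ih.trans ((hG.glue_adj H).2 ⟨i, _, _, h, rfl, rfl⟩).reachable

theorem exists_corner (hG : CornerGluing e c p t) {i : ι} {u : V} {q : τ} (h : e i u = p q) :
    ∃ a, u = c a ∧ t i a = q := by
  obtain ⟨j, b, rfl⟩ := hG.t_surj q
  by_cases hij : i = j
  · subst hij
    rw [← hG.corner] at h
    exact ⟨b, hG.inj _ h, rfl⟩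
  · rw [← hG.corner] at h
    obtain ⟨a, rfl⟩ := hG.meet hij h
    rw [hG.corner, hG.corner] at h
    exact ⟨a, rfl, hG.p_inj h⟩

theorem reachable_of_eqvGen (hG : CornerGluing e c p t) (H : ι → SimpleGraph V) {x y : τ}
    (h : Relation.EqvGen (cornerRel c t H) x y) : (glue e H).Reachable (p x) (p y) := by
  induction h with
  | rel x y h =>
    obtain ⟨i, a, b, rfl, rfl, h⟩ := h
    rw [← hG.corner, ← hG.corner]
    exact hG.reachable_map H h
  | refl x => exact SimpleGraph.Reachable.refl _
  | symm x y _ ih => exact ih.symm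
  | trans x y z _ _ ih ih' => exact ih.trans ih'

/-- Along a walk, keep track of the copy that contains the current vertex and of a corner of that
copy from which the vertex is reached inside it. A walk can change copies only at a shared corner,
which then becomes the new reference corner. -/
theorem exists_of_reachable (hG : CornerGluing e c p t) (H : ι → SimpleGraph V) {x : τ} {w : W}
    (h : (glue e H).Reachable (p x) w) :
    ∃ i a v, Relation.EqvGen (cornerRel c t H) x (t i a) ∧ (H i).Reachable (c a) v ∧
      e i v = w := by
  rw [SimpleGraph.reachable_iff_reflTransGen] at h
  induction h with
  | refl =>
    obtain ⟨i, a, rfl⟩ := hG.t_surj x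
    exact ⟨i, a, c a, .refl _, .refl _, hG.corner i a⟩
  | tail _ h ih =>
    obtain ⟨i, a, v, h₁, h₂, rfl⟩ := ih
    obtain ⟨j, u, u', h₃, h₄, rfl⟩ := (hG.glue_adj H).1 h
    by_cases hij : i = j
    · subst hij
      obtain rfl := hG.inj _ h₄
      exact ⟨i, a, u', h₁, h₂.trans h₃.reachable, rfl⟩
    · obtain ⟨b, rfl⟩ := hG.meet hij h₄.symm
      obtain ⟨b', rfl⟩ := hG.meet (Ne.symm hij) h₄
      rw [hG.corner, hG.corner] at h₄
      exact ⟨j, b', u', h₁.trans _ _ _ (.rel _ _ ⟨i, a, b, rfl, (hG.p_inj h₄).symm, h₂⟩),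
        h₃.reachable, rfl⟩

theorem reachable_iff (hG : CornerGluing e c p t) (H : ι → SimpleGraph V) {x y : τ} :
    (glue e H).Reachable (p x) (p y) ↔ Relation.EqvGen (cornerRel c t H) x y := by
  refine ⟨fun h => ?_, hG.reachable_of_eqvGen H⟩
  obtain ⟨i, a, v, h₁, h₂, h₃⟩ := hG.exists_of_reachable H h
  obtain ⟨b, rfl, rfl⟩ := hG.exists_corner h₃
  exact h₁.trans _ _ _ (.rel _ _ ⟨i, a, b, rfl, rfl, h₂⟩)

/-- Every vertex of the glued graph is connected to an outer corner if and only if every vertex of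
a copy is connected to a corner of that copy, and every glued corner to an outer one. -/
theorem forall_reachable_iff (hG : CornerGluing e c p t) (H : ι → SimpleGraph V) {O : Set τ} :
    (∀ w, ∃ o ∈ O, (glue e H).Reachable w (p o)) ↔
      (∀ i u, ∃ a, (H i).Reachable u (c a)) ∧
        ∀ q, ∃ o ∈ O, Relation.EqvGen (cornerRel c t H) q o := by
  constructor
  · refine fun h => ⟨fun i u => ?_, fun q => ?_⟩
    · obtain ⟨o, -, h⟩ := h (e i u)
      -- A walk from `e i u` stays in copy `i` until it leaves through a corner of it, and then the
      -- first alternative holds for good.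
      have key : ∀ w, Relation.ReflTransGen (glue e H).Adj (e i u) w →
          (∃ a, (H i).Reachable u (c a)) ∨ ∃ v, (H i).Reachable u v ∧ e i v = w := by
        intro w hw
        induction hw with
        | refl => exact .inr ⟨u, .refl _, rfl⟩
        | tail _ h ih =>
          rcases ih with ih | ⟨v, h₁, rfl⟩
          · exact .inl ih
          obtain ⟨j, v', w', h₃, h₄, rfl⟩ := (hG.glue_adj H).1 h
          by_cases hij : i = j
          · subst hij
            obtain rfl := hG.inj _ h₄
            exact .inr ⟨w', h₁.trans h₃.reachable, rfl⟩
          · obtain ⟨b, rfl⟩ := hG.meet hij h₄.symm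
            exact .inl ⟨b, h₁⟩
      rcases key _ ((SimpleGraph.reachable_iff_reflTransGen _ _).1 h) with h | ⟨v, h₁, h₂⟩
      · exact h
      · obtain ⟨b, rfl, rfl⟩ := hG.exists_corner h₂
        exact ⟨b, h₁⟩
    · obtain ⟨o, ho, h⟩ := h (p q)
      exact ⟨o, ho, (hG.reachable_iff H).1 h⟩
  · rintro ⟨h₁, h₂⟩ w
    obtain ⟨i, u, rfl⟩ := hG.cover w
    obtain ⟨a, ha⟩ := h₁ i u
    obtain ⟨o, ho, h⟩ := h₂ (t i a)
    refine ⟨o, ho, (hG.reachable_map H ha).trans ?_⟩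
    rw [hG.corner]
    exact hG.reachable_of_eqvGen H h

end CornerGluing

/-! ### States of a graph with three corners -/

/-- The five partitions of three corners, given by a labelling of the corners. -/
def cornerLabel (s : Fin 5) : Fin 3 → ℕ :=
  match s with
  | 0 => ![0, 0, 0]
  | 1 => ![0, 0, 2]
  | 2 => ![0, 1, 0]
  | 3 => ![0, 1, 1]
  | 4 => ![0, 1, 2]

/-- Every vertex of `H` is connected to a corner, and the components of `H` induce the partition
`s` of the corners. -/
def HasState {V : Type*} (c : Fin 3 → V) (s : Fin 5) (H : SimpleGraph V) : Prop :=
  (∀ u, ∃ a, H.Reachable u (c a)) ∧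
    ∀ a b, H.Reachable (c a) (c b) ↔ cornerLabel s a = cornerLabel s b

theorem HasState.unique {V : Type*} {c : Fin 3 → V} {s s' : Fin 5} {H : SimpleGraph V}
    (h : HasState c s H) (h' : HasState c s' H) : s = s' := by
  have key : ∀ s s' : Fin 5, (∀ a b, cornerLabel s a = cornerLabel s b ↔
      cornerLabel s' a = cornerLabel s' b) → s = s' := by decide
  exact key s s' fun a b => (h.2 a b).symm.trans (h'.2 a b)

theorem exists_hasState {V : Type*} {c : Fin 3 → V} {H : SimpleGraph V}
    (h : ∀ u, ∃ a, H.Reachable u (c a)) : ∃ s, HasState c s H := by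
  have s01 : H.Reachable (c 1) (c 0) ↔ H.Reachable (c 0) (c 1) := SimpleGraph.reachable_comm
  have s02 : H.Reachable (c 2) (c 0) ↔ H.Reachable (c 0) (c 2) := SimpleGraph.reachable_comm
  have s12 : H.Reachable (c 2) (c 1) ↔ H.Reachable (c 1) (c 2) := SimpleGraph.reachable_comm
  have t1 : H.Reachable (c 0) (c 1) → H.Reachable (c 1) (c 2) → H.Reachable (c 0) (c 2) :=
    fun h h' => h.trans h'
  have t2 : H.Reachable (c 0) (c 1) → H.Reachable (c 0) (c 2) → H.Reachable (c 1) (c 2) :=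
    fun h h' => h.symm.trans h'
  have t3 : H.Reachable (c 0) (c 2) → H.Reachable (c 1) (c 2) → H.Reachable (c 0) (c 1) :=
    fun h h' => h.trans h'.symm
  by_cases h01 : H.Reachable (c 0) (c 1)
  · by_cases h02 : H.Reachable (c 0) (c 2)
    · exact ⟨0, h, by simp [Fin.forall_fin_succ, cornerLabel, s01, s02, s12, h01, h02, t2 h01 h02]⟩
    · have h12 : ¬ H.Reachable (c 1) (c 2) := fun h' => h02 (t1 h01 h')
      exact ⟨1, h, by simp [Fin.forall_fin_succ, cornerLabel, s01, s02, s12, h01, h02, h12]⟩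
  · by_cases h02 : H.Reachable (c 0) (c 2)
    · have h12 : ¬ H.Reachable (c 1) (c 2) := fun h' => h01 (t3 h02 h')
      exact ⟨2, h, by simp [Fin.forall_fin_succ, cornerLabel, s01, s02, s12, h01, h02, h12]⟩
    · by_cases h12 : H.Reachable (c 1) (c 2)
      · exact ⟨3, h, by simp [Fin.forall_fin_succ, cornerLabel, s01, s02, s12, h01, h02, h12]⟩
      · exact ⟨4, h, by simp [Fin.forall_fin_succ, cornerLabel, s01, s02, s12, h01, h02, h12]⟩

/-- The number of spanning subgraphs of `G` with state `s`. -/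
noncomputable def stateCount {V : Type*} (G : SimpleGraph V) (c : Fin 3 → V) (s : Fin 5) : ℕ :=
  Set.ncard {H : SimpleGraph V | H ≤ G ∧ HasState c s H}

/-- The relation between glued corners that the states of the copies induce. -/
def stateRel {ι τ : Type*} (t : ι → Fin 3 → τ) (σ : ι → Fin 5) (x y : τ) : Prop :=
  ∃ i a b, t i a = x ∧ t i b = y ∧ cornerLabel (σ i) a = cornerLabel (σ i) b

/-- The copies with states `σ` are glued to a graph with outer corners `o` and state `s`. -/
def GluesTo {ι τ : Type*} (t : ι → Fin 3 → τ) (o : Fin 3 → τ) (σ : ι → Fin 5) (s : Fin 5) :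
    Prop :=
  (∀ q, ∃ a, Relation.EqvGen (stateRel t σ) q (o a)) ∧
    ∀ a b, Relation.EqvGen (stateRel t σ) (o a) (o b) ↔ cornerLabel s a = cornerLabel s b

namespace CornerGluing

variable {V W ι τ : Type*} {e : ι → V → W} {c : Fin 3 → V} {p : τ → W} {t : ι → Fin 3 → τ}

theorem cornerRel_eq_stateRel {H : ι → SimpleGraph V} {σ : ι → Fin 5}
    (h : ∀ i, HasState c (σ i) (H i)) : cornerRel c t H = stateRel t σ := by
  funext x y
  simp only [cornerRel, stateRel, (h _).2]

theorem hasState_glue_iff (hG : CornerGluing e c p t) (o : Fin 3 → τ) {H : ι → SimpleGraph V}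
    {σ : ι → Fin 5} (h : ∀ i, HasState c (σ i) (H i)) (s : Fin 5) :
    HasState (p ∘ o) s (glue e H) ↔ GluesTo t o σ s := by
  have := hG.forall_reachable_iff H (O := Set.range o)
  simp only [Set.exists_range_iff] at this
  rw [HasState, GluesTo, ← cornerRel_eq_stateRel (t := t) h]
  simp only [Function.comp_apply, hG.reachable_iff]
  rw [this, and_iff_right fun i => (h i).1]

theorem glue_comap (hG : CornerGluing e c p t) {G : SimpleGraph V} {H : SimpleGraph W}
    (h : H ≤ glue e fun _ => G) : glue e (fun i => H.comap (e i)) = H := by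
  ext x y
  rw [hG.glue_adj]
  constructor
  · rintro ⟨i, u, v, h, rfl, rfl⟩
    exact h
  · intro h'
    obtain ⟨i, u, v, -, rfl, rfl⟩ := (hG.glue_adj _).1 (h h')
    exact ⟨i, u, v, h', rfl, rfl⟩

/-- Restriction to the copies inverts `glue`, and each restriction has a state because its vertices
reach corners. Since states are unique, the subgraphs fall into disjoint classes indexed by `σ`, and
each class is a product. -/
theorem stateCount_glue [Fintype V] [Fintype W] [Fintype ι] [DecidableEq ι]
    (hG : CornerGluing e c p t)
    (o : Fin 3 → τ) (G : SimpleGraph V) (s : Fin 5)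
    [DecidablePred fun σ : ι → Fin 5 => GluesTo t o σ s] :
    stateCount (glue e fun _ => G) (p ∘ o) s =
      ∑ σ : ι → Fin 5, if GluesTo t o σ s then ∏ i, stateCount G c (σ i) else 0 := by
  classical
  let A : Fin 5 → Finset (SimpleGraph V) := fun s => {H | H ≤ G ∧ HasState c s H}
  have hA : ∀ s, stateCount G c s = (A s).card := fun s => by
    rw [stateCount, ← Set.ncard_coe_finset]
    congr 1
    ext H
    simp [A]
  have hB : {H | H ≤ glue e (fun _ => G) ∧ HasState (p ∘ o) s H} =
      ((({σ | GluesTo t o σ s} : Finset (ι → Fin 5)).biUnion fun σ =>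
        (Fintype.piFinset fun i => A (σ i)).image (glue e) : Finset (SimpleGraph W)) :
        Set (SimpleGraph W)) := by
    ext H
    simp only [Set.mem_ofPred_eq, Finset.coe_biUnion, Finset.coe_filter, Finset.mem_univ, true_and,
      Set.mem_iUnion, Finset.coe_image, Set.mem_image, Finset.mem_coe, Fintype.mem_piFinset,
      Finset.mem_filter, A, exists_prop]
    constructor
    · rintro ⟨h₁, h₂⟩
      have h₃ := hG.glue_comap h₁
      have h₄ : ∀ i, ∃ s, HasState c s (H.comap (e i)) := by
        have := (hG.forall_reachable_iff (fun i => H.comap (e i)) (O := Set.range o)).1 (by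
          rw [h₃]
          simpa only [Set.exists_range_iff, Function.comp_apply] using h₂.1)
        exact fun i => exists_hasState (this.1 i)
      choose σ hσ using h₄
      rw [← h₃] at h₂
      refine ⟨σ, (hG.hasState_glue_iff o hσ s).1 h₂, _, fun i => ⟨?_, hσ i⟩, h₃⟩
      rw [← hG.comap_glue (fun _ => G) i]
      exact fun u v h => h₁ h
    · rintro ⟨σ, h, H, hH, rfl⟩
      refine ⟨?_, (hG.hasState_glue_iff o (fun i => (hH i).2) s).2 h⟩
      exact iSup_mono fun i => SimpleGraph.map_monotone _ (hH i).1
  have hinj : Function.Injective (glue e) := fun H H' h => by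
    funext i
    rw [← hG.comap_glue H i, h, hG.comap_glue H' i]
  rw [stateCount, hB, Set.ncard_coe_finset, Finset.card_biUnion, ← Finset.sum_filter]
  · refine Finset.sum_congr rfl fun σ _ => ?_
    rw [Finset.card_image_of_injective _ hinj, Fintype.card_piFinset]
    exact Finset.prod_congr rfl fun i _ => (hA _).symm
  · intro σ _ σ' _ hne
    rw [Function.onFun, Finset.disjoint_image hinj, Finset.disjoint_left]
    intro H h h'
    refine hne (funext fun i => ?_)
    have h₁ := Fintype.mem_piFinset.1 h i
    have h₂ := Fintype.mem_piFinset.1 h' i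
    simp only [A, Finset.mem_filter] at h₁ h₂
    exact h₁.2.2.unique h₂.2.2

end CornerGluing

/-! ### Relations on ten points as binary numbers -/

section BitRelations

/-- The relation on `Fin 10` that the binary digits of `M` encode. -/
def bitRel (M : ℕ) (x y : Fin 10) : Prop := M.testBit (10 * x + y) = true

/-- On encodings of equivalence relations: identify the classes of `a` and `b`. -/
def mergeBits (M a b : ℕ) : ℕ :=
  Nat.lor M (Nat.mul
    (Nat.land (Nat.lor (Nat.shiftRight M a) (Nat.shiftRight M b)) 1239150146850664126585242625)
    (Nat.land (Nat.lor (Nat.shiftRight M (Nat.mul 10 a)) (Nat.shiftRight M (Nat.mul 10 b))) 1023))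

/-- The bits of `C` sit at multiples of 10 and `B` has at most ten bits, so the shifted copies of
`B` in the product do not overlap and no carries occur: the product is the outer product of two bit
vectors. The induction strips off blocks of ten bits. -/
theorem testBit_mul_of_sparse {B : ℕ} (hB : B < 2 ^ 10) {j : ℕ} (hj : j < 10) :
    ∀ (i C : ℕ), (∀ k, k % 10 ≠ 0 → C.testBit k = false) →
      (C * B).testBit (10 * i + j) = (C.testBit (10 * i) && B.testBit j) := by
  have split : ∀ C : ℕ, (∀ k, k % 10 ≠ 0 → C.testBit k = false) →
      C = 2 ^ 10 * (C / 2 ^ 10) + (C.testBit 0).toNat := fun C hC => by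
    have h : C % 2 ^ 10 = (C.testBit 0).toNat := by
      refine Nat.eq_of_testBit_eq fun k => ?_
      rw [Nat.testBit_mod_two_pow]
      rcases Nat.eq_zero_or_pos k with rfl | hk
      · cases C.testBit 0 <;> simp
      · have : (C.testBit 0).toNat.testBit k = false := by
          cases C.testBit 0
          · simp
          · exact Nat.testBit_lt_two_pow (Nat.one_lt_two_pow hk.ne')
        rw [this]
        by_cases hk' : k < 10
        · simp [hC k (by omega)]
        · simp [hk']
    rw [← h, Nat.div_add_mod]
  intro i
  induction i with
  | zero =>
    intro C hC
    have h : C * B = 2 ^ 10 * (C / 2 ^ 10 * B) + (C.testBit 0).toNat * B := by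
      conv_lhs => rw [split C hC]
      ring
    have hlt : (C.testBit 0).toNat * B < 2 ^ 10 := by
      cases C.testBit 0
      · simp
      · simpa using hB
    rw [h, Nat.testBit_two_pow_mul_add _ hlt]
    cases C.testBit 0 <;> simp [hj]
  | succ i ih =>
    intro C hC
    have h : C * B = 2 ^ 10 * (C / 2 ^ 10 * B) + (C.testBit 0).toNat * B := by
      conv_lhs => rw [split C hC]
      ring
    have hlt : (C.testBit 0).toNat * B < 2 ^ 10 := by
      cases C.testBit 0
      · simp
      · simpa using hB
    have e1 : 10 * (i + 1) + j - 10 = 10 * i + j := by omega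
    have e2 : 10 * i + 10 = 10 * (i + 1) := by ring
    rw [h, Nat.testBit_two_pow_mul_add _ hlt, if_neg (by omega), e1, ih, Nat.testBit_div_two_pow,
      e2]
    intro k hk
    rw [Nat.testBit_div_two_pow]
    exact hC _ (by omega)

/-- The constant is the sum of 2 ^ (10 i) over i < 10. Applied after a shift by `a`, it cuts column
`a` out of the 10 × 10 bit matrix. -/
theorem testBit_columnMask (k : ℕ) :
    Nat.testBit 1239150146850664126585242625 k = decide (k % 10 = 0 ∧ k < 100) := by
  by_cases hk : k < 100
  · have : ∀ k < 100, Nat.testBit 1239150146850664126585242625 k =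
      decide (k % 10 = 0 ∧ k < 100) := by decide +kernel
    exact this k hk
  · simp only [hk, and_false, decide_false]
    refine Nat.testBit_lt_two_pow (lt_of_lt_of_le ?_ (Nat.pow_le_pow_right two_pos (not_lt.1 hk)))
    norm_num

theorem bitRel_mergeBits_iff (M : ℕ) (a b x y : Fin 10) :
    bitRel (mergeBits M a b) x y ↔
      bitRel M x y ∨ (bitRel M x a ∨ bitRel M x b) ∧ (bitRel M a y ∨ bitRel M b y) := by
  have h : mergeBits M a b = M ||| ((M >>> (a : ℕ) ||| M >>> (b : ℕ)) &&&
    1239150146850664126585242625) * ((M >>> (10 * a : ℕ) ||| M >>> (10 * b : ℕ)) &&& (2 ^ 10 - 1)) :=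
    rfl
  have hx : ((10 * (x : ℕ)) % 10 = 0 ∧ 10 * (x : ℕ) < 100) := by omega
  rw [bitRel, h, Nat.testBit_or, testBit_mul_of_sparse]
  · simp only [Nat.testBit_and, Nat.testBit_or, Nat.testBit_shiftRight, testBit_columnMask,
      Nat.testBit_two_pow_sub_one, y.2, hx, Bool.or_eq_true, Bool.and_eq_true, decide_true,
      and_true, and_self, bitRel, add_comm]
  · rw [Nat.and_two_pow_sub_one_eq_mod]
    exact Nat.mod_lt _ (by norm_num)
  · exact y.2
  · intro k hk
    simp [testBit_columnMask, hk]

end BitRelations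

/-! ### Merging classes and generated equivalence relations -/

section EqvGen

open Relation

theorem Relation.EqvGen.le_of_equivalence {τ : Type*} {r R : τ → τ → Prop} (hR : Equivalence R)
    (h : ∀ x y, r x y → R x y) {x y : τ} (hxy : EqvGen r x y) : R x y :=
  hR.eqvGen_iff.1 (hxy.mono h)

theorem eqvGen_eqvGen_or {τ : Type*} (r s : τ → τ → Prop) :
    EqvGen (fun x y => EqvGen r x y ∨ s x y) = EqvGen fun x y => r x y ∨ s x y := by
  funext x y
  refine propext ⟨EqvGen.le_of_equivalence (EqvGen.is_equivalence _) ?_, fun h => h.mono ?_⟩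
  · rintro x y (h | h)
    · exact h.mono fun _ _ => .inl
    · exact .rel _ _ (.inr h)
  · exact fun x y => Or.imp_left (.rel _ _)

/-- A chain that uses the new pair enters and leaves the union of the classes of `a` and `b`; what
happens in between can be cut out. So a single merge is already transitive, and no closure has to be
iterated. -/
theorem bitRel_mergeBits {M : ℕ} (hM : Equivalence (bitRel M)) (a b : Fin 10) :
    bitRel (mergeBits M a b) = EqvGen fun x y => bitRel M x y ∨ x = a ∧ y = b := by
  funext x y
  rw [bitRel_mergeBits_iff]
  refine propext ⟨?_, fun h => ?_⟩
  · have hE := EqvGen.is_equivalence fun x y => bitRel M x y ∨ x = a ∧ y = b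
    have h₁ : ∀ {x y}, bitRel M x y → EqvGen (fun x y => bitRel M x y ∨ x = a ∧ y = b) x y :=
      fun h => .rel _ _ (.inl h)
    have h₂ : EqvGen (fun x y => bitRel M x y ∨ x = a ∧ y = b) a b := .rel _ _ (.inr ⟨rfl, rfl⟩)
    rintro (h | ⟨h | h, h' | h'⟩)
    · exact h₁ h
    · exact hE.trans (h₁ h) (h₁ h')
    · exact hE.trans (h₁ h) (hE.trans h₂ (h₁ h'))
    · exact hE.trans (h₁ h) (hE.trans (hE.symm h₂) (h₁ h'))
    · exact hE.trans (h₁ h) (h₁ h')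
  · have key : ∀ {x y z}, bitRel M x y → bitRel M y z → bitRel M x z := hM.trans
    have hs : ∀ {x y}, bitRel M x y → bitRel M y x := hM.symm
    induction h with
    | rel x y h =>
      rcases h with h | ⟨rfl, rfl⟩
      · exact .inl h
      · exact .inr ⟨.inl (hM.refl _), .inr (hM.refl _)⟩
    | refl x => exact .inl (hM.refl x)
    | symm x y _ ih => exact ih.imp hs fun h => ⟨h.2.imp hs hs, h.1.imp hs hs⟩
    | trans x y z _ _ ih ih' =>
      rcases ih with h | ⟨h₁, h₂⟩
      · rcases ih' with h' | ⟨h₁', h₂'⟩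
        · exact .inl (key h h')
        · exact .inr ⟨h₁'.imp (key h) (key h), h₂'⟩
      · rcases ih' with h' | ⟨h₁', h₂'⟩
        · exact .inr ⟨h₁, h₂.imp (fun h => key h h') fun h => key h h'⟩
        · exact .inr ⟨h₁, h₂'⟩

/-- The relation between glued corners that the state `s` of a copy with corners `v` induces. -/
def copyRel {τ : Type*} (v : Fin 3 → τ) (s : Fin 5) (x y : τ) : Prop :=
  ∃ a b, v a = x ∧ v b = y ∧ cornerLabel s a = cornerLabel s b

theorem stateRel_cons {τ : Type*} {n : ℕ} (t : Fin (n + 1) → Fin 3 → τ) (s : Fin 5)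
    (σ : Fin n → Fin 5) (x y : τ) :
    stateRel t (Fin.cons s σ : Fin (n + 1) → Fin 5) x y ↔
      copyRel (t 0) s x y ∨ stateRel (Fin.tail t) σ x y := by
  simp only [stateRel, copyRel, Fin.exists_fin_succ, Fin.cons_zero, Fin.cons_succ, Fin.tail]

/-- Identify the corners of a copy as its state prescribes. -/
def mergeState (M a b c : ℕ) (s : Fin 5) : ℕ :=
  match s with
  | 0 => mergeBits (mergeBits M a b) b c
  | 1 => mergeBits M a b
  | 2 => mergeBits M a c
  | 3 => mergeBits M b c
  | 4 => M

theorem eqvGen_or_copyRel_le {τ : Type*} {r R : τ → τ → Prop} (hR : Equivalence R)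
    (h : ∀ x y, r x y → R x y) {v : Fin 3 → τ} {s : Fin 5}
    (hs : ∀ a b, a < b → cornerLabel s a = cornerLabel s b → R (v a) (v b)) {x y : τ}
    (hxy : EqvGen (fun x y => r x y ∨ copyRel v s x y) x y) : R x y := by
  refine hxy.le_of_equivalence hR ?_
  rintro x y (h' | ⟨a, b, rfl, rfl, hab⟩)
  · exact h x y h'
  · rcases lt_trichotomy a b with hlt | rfl | hlt
    · exact hs a b hlt hab
    · exact hR.refl _
    · exact hR.symm (hs b a hlt hab.symm)

/-- At most two merges generate all the identifications of a state; in state `0` the pair of corners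
0, 2 follows by transitivity. -/
theorem bitRel_mergeState {M : ℕ} (hM : Equivalence (bitRel M)) (v : Fin 3 → Fin 10) (s : Fin 5) :
    bitRel (mergeState M (v 0) (v 1) (v 2) s) =
      EqvGen fun x y => bitRel M x y ∨ copyRel v s x y := by
  have pair : ∀ a b, cornerLabel s a = cornerLabel s b →
      bitRel (mergeBits M (v a) (v b)) ≤ EqvGen fun x y => bitRel M x y ∨ copyRel v s x y := by
    intro a b hab x y h
    rw [bitRel_mergeBits hM] at h
    refine h.mono ?_
    rintro x y (h | ⟨rfl, rfl⟩)
    · exact .inl h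
    · exact .inr ⟨a, b, rfl, rfl, hab⟩
  have eqv : ∀ a b, Equivalence (bitRel (mergeBits M (v a) (v b))) := fun a b => by
    rw [bitRel_mergeBits hM]
    exact EqvGen.is_equivalence _
  have left : ∀ a b x y, bitRel M x y → bitRel (mergeBits M (v a) (v b)) x y := fun a b x y h => by
    rw [bitRel_mergeBits hM]
    exact .rel _ _ (.inl h)
  have right : ∀ a b, bitRel (mergeBits M (v a) (v b)) (v a) (v b) := fun a b => by
    rw [bitRel_mergeBits hM]
    exact .rel _ _ (.inr ⟨rfl, rfl⟩)
  refine le_antisymm ?_ ?_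
  · fin_cases s
    · intro x y h
      change bitRel (mergeBits (mergeBits M (v 0) (v 1)) (v 1) (v 2)) x y at h
      rw [bitRel_mergeBits (eqv 0 1)] at h
      refine h.le_of_equivalence (EqvGen.is_equivalence _) ?_
      rintro x y (h | ⟨rfl, rfl⟩)
      · exact pair 0 1 rfl _ _ h
      · exact .rel _ _ (.inr ⟨1, 2, rfl, rfl, rfl⟩)
    · exact pair 0 1 rfl
    · exact pair 0 2 rfl
    · exact pair 1 2 rfl
    · exact fun x y h => .rel _ _ (.inl h)
  · intro x y h
    fin_cases s
    · change bitRel (mergeBits (mergeBits M (v 0) (v 1)) (v 1) (v 2)) x y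
      rw [bitRel_mergeBits (eqv 0 1)]
      have hE := EqvGen.is_equivalence fun x y =>
        bitRel (mergeBits M (v 0) (v 1)) x y ∨ x = v 1 ∧ y = v 2
      have h01 : EqvGen (fun x y => bitRel (mergeBits M (v 0) (v 1)) x y ∨ x = v 1 ∧ y = v 2)
        (v 0) (v 1) := .rel _ _ (.inl (right 0 1))
      have h12 : EqvGen (fun x y => bitRel (mergeBits M (v 0) (v 1)) x y ∨ x = v 1 ∧ y = v 2)
        (v 1) (v 2) := .rel _ _ (.inr ⟨rfl, rfl⟩)
      refine eqvGen_or_copyRel_le hE (fun x y h => .rel _ _ (.inl (left 0 1 x y h))) ?_ h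
      intro a b hlt _
      fin_cases a <;> fin_cases b <;> first | exact absurd hlt (by decide) | skip
      · exact h01
      · exact hE.trans h01 h12
      · exact h12
    · refine eqvGen_or_copyRel_le (eqv 0 1) (left 0 1) ?_ h
      intro a b hlt hab
      fin_cases a <;> fin_cases b <;>
        first | exact absurd hlt (by decide) | exact absurd hab (by decide) | exact right 0 1
    · refine eqvGen_or_copyRel_le (eqv 0 2) (left 0 2) ?_ h
      intro a b hlt hab
      fin_cases a <;> fin_cases b <;>
        first | exact absurd hlt (by decide) | exact absurd hab (by decide) | exact right 0 2
    · refine eqvGen_or_copyRel_le (eqv 1 2) (left 1 2) ?_ h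
      intro a b hlt hab
      fin_cases a <;> fin_cases b <;>
        first | exact absurd hlt (by decide) | exact absurd hab (by decide) | exact right 1 2
    · refine eqvGen_or_copyRel_le hM (fun _ _ h => h) ?_ h
      intro a b hlt hab
      fin_cases a <;> fin_cases b <;>
        first | exact absurd hlt (by decide) | exact absurd hab (by decide)

end EqvGen

open Relation in
-- This permits choosing the states copy by copy, with `M` as the only memory of earlier choices.
theorem eqvGen_or_stateRel_cons {n M : ℕ} (hM : Equivalence (bitRel M))
    (t : Fin (n + 1) → Fin 3 → Fin 10) (s : Fin 5) (σ : Fin n → Fin 5) :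
    EqvGen (fun x y => bitRel M x y ∨ stateRel t (Fin.cons s σ : Fin (n + 1) → Fin 5) x y) =
      EqvGen fun x y => bitRel (mergeState M (t 0 0) (t 0 1) (t 0 2) s) x y ∨
        stateRel (Fin.tail t) σ x y := by
  rw [bitRel_mergeState hM (t 0) s, eqvGen_eqvGen_or]
  simp only [stateRel_cons, or_assoc]

/-! ### Enumeration of the state assignments -/

/-- Whether the relation that `M` encodes on the glued corners has the pattern `x`, `y`, `z` on the
outer corners `0`, `3`, `9`, and relates every glued corner to an outer one. -/
def checkBits (x y z : Bool) (M : ℕ) : Bool :=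
  Nat.beq (Nat.lor (Nat.lor (Nat.land M 1023) (Nat.land (Nat.shiftRight M 30) 1023))
    (Nat.land (Nat.shiftRight M 90) 1023)) 1023 &&
  (Nat.testBit M 3 == x) && (Nat.testBit M 9 == y) && (Nat.testBit M 39 == z)

def outerCorners : Fin 3 → Fin 10 := ![0, 3, 9]

/-- The relation `r` on the glued corners describes a graph with state `s`. -/
def RelHasState (r : Fin 10 → Fin 10 → Prop) (s : Fin 5) : Prop :=
  (∀ q, ∃ a, r q (outerCorners a)) ∧
    ∀ a b, r (outerCorners a) (outerCorners b) ↔ cornerLabel s a = cornerLabel s b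

def samePart (s : Fin 5) (a b : Fin 3) : Bool := cornerLabel s a == cornerLabel s b

theorem checkBits_iff {M : ℕ} (hM : Equivalence (bitRel M)) (s : Fin 5) :
    checkBits (samePart s 0 1) (samePart s 0 2) (samePart s 1 2) M = true ↔
      RelHasState (bitRel M) s := by
  have h₁ : Nat.beq (Nat.lor (Nat.lor (Nat.land M 1023) (Nat.land (Nat.shiftRight M 30) 1023))
      (Nat.land (Nat.shiftRight M 90) 1023)) 1023 = true ↔
      ∀ q, ∃ a, bitRel M q (outerCorners a) := by
    have e : Nat.lor (Nat.lor (Nat.land M 1023) (Nat.land (Nat.shiftRight M 30) 1023))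
      (Nat.land (Nat.shiftRight M 90) 1023) = (M &&& (2 ^ 10 - 1)) |||
        ((M >>> 30) &&& (2 ^ 10 - 1)) ||| ((M >>> 90) &&& (2 ^ 10 - 1)) := rfl
    have e' : 1023 = 2 ^ 10 - 1 := rfl
    rw [Nat.beq_eq, e, e', Fin.forall_iff]
    refine Iff.trans ⟨fun h k => congrArg (Nat.testBit · k) h, Nat.eq_of_testBit_eq⟩
      (forall_congr' fun k => ?_)
    simp only [Nat.testBit_or, Nat.testBit_and, Nat.testBit_two_pow_sub_one, Nat.testBit_shiftRight]
    by_cases hk : k < 10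
    · have hs : ∀ a, bitRel M ⟨k, hk⟩ a ↔ bitRel M a ⟨k, hk⟩ := fun a => ⟨hM.symm, hM.symm⟩
      have h0 : M.testBit (10 * k) = M.testBit k := by
        have h : M.testBit (10 * k + 0) = M.testBit (0 + k) := Bool.eq_iff_iff.2 (hs 0)
        rwa [add_zero, zero_add] at h
      have h3 : M.testBit (10 * k + 3) = M.testBit (30 + k) := Bool.eq_iff_iff.2 (hs 3)
      have h9 : M.testBit (10 * k + 9) = M.testBit (90 + k) := Bool.eq_iff_iff.2 (hs 9)
      simp [hk, h0, h3, h9, Fin.exists_fin_succ, outerCorners, bitRel, or_assoc]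
    · simp [hk]
  have h₂ : ∀ {x y : Fin 10}, bitRel M x y ↔ bitRel M y x := ⟨hM.symm, hM.symm⟩
  have h₃ : ∀ x, bitRel M x x := hM.refl
  have e1 : Nat.testBit M 3 = true ↔ bitRel M 0 3 := Iff.rfl
  have e2 : Nat.testBit M 9 = true ↔ bitRel M 0 9 := Iff.rfl
  have e3 : Nat.testBit M 39 = true ↔ bitRel M 3 9 := Iff.rfl
  have beq_iff : ∀ {b : Bool} {p q : Prop} [Decidable q], (b = true ↔ p) →
      ((b == decide q) = true ↔ (p ↔ q)) := by
    intro b p q _ h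
    rw [← h]
    cases b <;> simp
  rw [checkBits, Bool.and_eq_true, Bool.and_eq_true, Bool.and_eq_true, h₁, RelHasState, and_assoc,
    and_assoc]
  refine and_congr_right fun _ => ?_
  have d : ∀ a b, samePart s a b = decide (cornerLabel s a = cornerLabel s b) := fun _ _ => rfl
  rw [d, d, d, beq_iff e1, beq_iff e2, beq_iff e3]
  constructor
  · rintro ⟨i, j, k⟩ a b
    fin_cases a <;> fin_cases b <;>
      first
        | exact iff_of_true (h₃ _) rfl
        | exact i | exact j | exact k
        | exact h₂.trans (i.trans eq_comm)
        | exact h₂.trans (j.trans eq_comm)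
        | exact h₂.trans (k.trans eq_comm)
  · exact fun h => ⟨h 0 1, h 0 2, h 1 2⟩

/-- Prepend the results of `F` for the five states of a copy with corners `a`, `b`, `c`. -/
def branch (a b c : ℕ) (F : ℕ → ℕ → ℕ → ℕ → List (ℕ × ℕ × ℕ) → List (ℕ × ℕ × ℕ))
    (M i j k : ℕ) (acc : List (ℕ × ℕ × ℕ)) : List (ℕ × ℕ × ℕ) :=
  F (mergeBits (mergeBits M a b) b c) (Nat.succ i) j k
   (F (mergeBits M a b) i (Nat.succ j) k
   (F (mergeBits M a c) i (Nat.succ j) k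
   (F (mergeBits M b c) i (Nat.succ j) k (F M i j (Nat.succ k) acc))))

def leaf (x y z : Bool) (M i j k : ℕ) (acc : List (ℕ × ℕ × ℕ)) : List (ℕ × ℕ × ℕ) :=
  bif checkBits x y z M then (i, j, k) :: acc else acc

/-- For all the choices of states of `n` copies with corners `t` that lead to the state `s`: the
numbers of copies with one, two and three components. -/
def leaves (s : Fin 5) :
    ∀ n, (Fin n → Fin 3 → Fin 10) → ℕ → ℕ → ℕ → ℕ → List (ℕ × ℕ × ℕ) → List (ℕ × ℕ × ℕ)
  | 0, _ => leaf (samePart s 0 1) (samePart s 0 2) (samePart s 1 2)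
  | n + 1, t => branch (t 0 0) (t 0 1) (t 0 2) (leaves s n (Fin.tail t))

def monomial (x y z : ℕ) (k : ℕ × ℕ × ℕ) : ℕ := x ^ k.1 * y ^ k.2.1 * z ^ k.2.2

open Relation in
open scoped Classical in
-- The induction needs arbitrary `M`, exponents and accumulator: `M` holds the identifications made
-- by the copies already treated, the monomial their weights, and `acc` the output of the branches
-- evaluated earlier.
theorem sum_leaves (s : Fin 5) (x y z : ℕ) (n : ℕ) :
    ∀ (t : Fin n → Fin 3 → Fin 10) (M i j k : ℕ) (acc : List (ℕ × ℕ × ℕ)),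
      Equivalence (bitRel M) →
      ((leaves s n t M i j k acc).map (monomial x y z)).sum =
        monomial x y z (i, j, k) * (∑ σ : Fin n → Fin 5,
          if RelHasState (EqvGen fun x y => bitRel M x y ∨ stateRel t σ x y) s then
            ∏ m, ![x, y, y, y, z] (σ m) else 0) + (acc.map (monomial x y z)).sum := by
  induction n with
  | zero =>
    intro t M i j k acc hM
    have h : ∀ σ, (EqvGen fun x y => bitRel M x y ∨ stateRel t σ x y) = bitRel M := fun σ => by
      have : ∀ x y, ¬ stateRel t σ x y := fun x y ⟨i, _⟩ => i.elim0
      simp only [this, or_false]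
      funext x y
      exact propext hM.eqvGen_iff
    rw [Fintype.sum_unique, h, leaves, leaf, ← checkBits_iff hM s]
    cases checkBits (samePart s 0 1) (samePart s 0 2) (samePart s 1 2) M <;> simp
  | succ n ih =>
    intro t M i j k acc hM
    have hmerge : ∀ u, Equivalence (bitRel (mergeState M (t 0 0) (t 0 1) (t 0 2) u)) := fun u => by
      rw [bitRel_mergeState hM (t 0)]
      exact EqvGen.is_equivalence _
    have hsum : ∀ F : (Fin (n + 1) → Fin 5) → ℕ, ∑ σ, F σ =
        ∑ u : Fin 5, ∑ σ : Fin n → Fin 5, F (Fin.cons u σ : Fin (n + 1) → Fin 5) := fun F => by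
      rw [← Fintype.sum_prod_type', ← (Fin.consEquiv fun _ => Fin 5).sum_comp]
      rfl
    rw [hsum]
    simp only [eqvGen_or_stateRel_cons hM, Fin.prod_univ_succ (n := n), Fin.cons_zero,
      Fin.cons_succ]
    simp only [← mul_ite_zero, ← Finset.mul_sum]
    rw [Fin.sum_univ_five]
    change ((leaves s n (Fin.tail t) (mergeState M (t 0 0) (t 0 1) (t 0 2) 0) _ _ _
      (leaves s n (Fin.tail t) (mergeState M (t 0 0) (t 0 1) (t 0 2) 1) _ _ _
      (leaves s n (Fin.tail t) (mergeState M (t 0 0) (t 0 1) (t 0 2) 2) _ _ _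
      (leaves s n (Fin.tail t) (mergeState M (t 0 0) (t 0 1) (t 0 2) 3) _ _ _
      (leaves s n (Fin.tail t) (mergeState M (t 0 0) (t 0 1) (t 0 2) 4) _ _ _ acc))))).map
        (monomial x y z)).sum = _
    rw [ih _ _ _ _ _ _ (hmerge 0), ih _ _ _ _ _ _ (hmerge 1), ih _ _ _ _ _ _ (hmerge 2),
      ih _ _ _ _ _ _ (hmerge 3), ih _ _ _ _ _ _ (hmerge 4)]
    simp only [monomial, Nat.succ_eq_add_one, pow_succ, mergeState]
    simp only [Matrix.cons_val]
    ring

/-- The glued corners of the six copies in a gasket: left, right and top corner of every copy. -/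
def gasketCorner : Fin 6 → Fin 3 → Fin 10 :=
  ![![0, 1, 4], ![1, 2, 5], ![2, 3, 6], ![4, 5, 7], ![5, 6, 8], ![7, 8, 9]]

/-- The encoding of the equality relation on `Fin 10`. -/
def equalityBits : ℕ := 634134936313486520338360567809

theorem bitRel_equalityBits : bitRel equalityBits = Eq := by
  have h : ∀ x y : Fin 10, Nat.testBit equalityBits (10 * x + y) = decide (x = y) := by
    decide +kernel
  funext x y
  simp [bitRel, h]

def gasketLeaves (s : Fin 5) : List (ℕ × ℕ × ℕ) := leaves s 6 gasketCorner equalityBits 0 0 0 []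

/-- The list `L` consists of the elements of `D`, with multiplicities `C`. -/
def hasCounts (L D : List (ℕ × ℕ × ℕ)) (C : List ℕ) : Bool :=
  L.all (fun k => D.contains k) && (D.map fun k => L.count k) == C

theorem sum_map_of_hasCounts {L D : List (ℕ × ℕ × ℕ)} {C : List ℕ} (h : hasCounts L D C = true)
    (hD : D.Nodup) (w : ℕ × ℕ × ℕ → ℕ) :
    (L.map w).sum = (List.zipWith (fun k m => m * w k) D C).sum := by
  rw [hasCounts, Bool.and_eq_true, List.all_eq_true, beq_iff_eq] at h
  obtain ⟨h₁, rfl⟩ := h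
  have hsub : L.toFinset ⊆ D.toFinset := fun k hk => by
    simpa using h₁ k (List.mem_toFinset.1 hk)
  have hb : instBEqProd = (instBEqOfDecidableEq : BEq (ℕ × ℕ × ℕ)) :=
    lawful_beq_subsingleton _ _
  rw [Finset.sum_list_map_count, Finset.sum_subset hsub, List.sum_toFinset _ hD,
    List.zipWith_map_right, List.zipWith_self, hb]
  · rfl
  · intro k _ hk
    rw [← hb, List.count_eq_zero_of_not_mem (by simpa using hk), zero_smul]

/-- The coefficients of the recursions originate in this computation and the next four, each of
which runs through all 5 ^ 6 assignments. -/
theorem hasCounts_connected : hasCounts (gasketLeaves 0)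
    [(3, 3, 0), (4, 1, 1), (4, 2, 0), (5, 0, 1), (5, 1, 0), (6, 0, 0)]
    [142, 18, 78, 3, 15, 1] = true := by
  decide +kernel

theorem hasCounts_discrete : hasCounts (gasketLeaves 4)
    [(1, 5, 0), (2, 3, 1), (2, 4, 0), (3, 1, 2), (3, 2, 1), (3, 3, 0), (4, 0, 2), (4, 1, 1),
      (4, 2, 0)]
    [468, 564, 279, 60, 129, 51, 3, 6, 3] = true := by
  decide +kernel

theorem hasCounts_top_apart : hasCounts (gasketLeaves 1)
    [(2, 4, 0), (3, 2, 1), (3, 3, 0), (4, 0, 2), (4, 1, 1), (4, 2, 0), (5, 0, 1), (5, 1, 0)]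
    [171, 77, 89, 2, 18, 16, 1, 1] = true := by
  decide +kernel

theorem hasCounts_right_apart : hasCounts (gasketLeaves 2)
    [(2, 4, 0), (3, 2, 1), (3, 3, 0), (4, 0, 2), (4, 1, 1), (4, 2, 0), (5, 0, 1), (5, 1, 0)]
    [171, 77, 89, 2, 18, 16, 1, 1] = true := by
  decide +kernel

theorem hasCounts_left_apart : hasCounts (gasketLeaves 3)
    [(2, 4, 0), (3, 2, 1), (3, 3, 0), (4, 0, 2), (4, 1, 1), (4, 2, 0), (5, 0, 1), (5, 1, 0)]
    [171, 77, 89, 2, 18, 16, 1, 1] = true := by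
  decide +kernel

def connectedPoly (x y z : ℕ) : ℕ :=
  142 * x ^ 3 * y ^ 3 + 18 * x ^ 4 * y * z + 78 * x ^ 4 * y ^ 2 + 3 * x ^ 5 * z + 15 * x ^ 5 * y +
    x ^ 6

def apartPoly (x y z : ℕ) : ℕ :=
  171 * x ^ 2 * y ^ 4 + 77 * x ^ 3 * y ^ 2 * z + 89 * x ^ 3 * y ^ 3 + 2 * x ^ 4 * z ^ 2 +
    18 * x ^ 4 * y * z + 16 * x ^ 4 * y ^ 2 + x ^ 5 * z + x ^ 5 * y

def discretePoly (x y z : ℕ) : ℕ :=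
  468 * x * y ^ 5 + 564 * x ^ 2 * y ^ 3 * z + 279 * x ^ 2 * y ^ 4 + 60 * x ^ 3 * y * z ^ 2 +
    129 * x ^ 3 * y ^ 2 * z + 51 * x ^ 3 * y ^ 3 + 3 * x ^ 4 * z ^ 2 + 6 * x ^ 4 * y * z +
    3 * x ^ 4 * y ^ 2

theorem sum_gasketLeaves (x y z : ℕ) (s : Fin 5) :
    ((gasketLeaves s).map (monomial x y z)).sum =
      ![connectedPoly x y z, apartPoly x y z, apartPoly x y z, apartPoly x y z,
        discretePoly x y z] s := by
  fin_cases s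
  · refine (sum_map_of_hasCounts hasCounts_connected (by decide) _).trans ?_
    simp [monomial, connectedPoly]
    ring
  · refine (sum_map_of_hasCounts hasCounts_top_apart (by decide) _).trans ?_
    simp [monomial, apartPoly]
    ring
  · refine (sum_map_of_hasCounts hasCounts_right_apart (by decide) _).trans ?_
    simp [monomial, apartPoly]
    ring
  · refine (sum_map_of_hasCounts hasCounts_left_apart (by decide) _).trans ?_
    simp [monomial, apartPoly]
    ring
  · refine (sum_map_of_hasCounts hasCounts_discrete (by decide) _).trans ?_
    simp [monomial, discretePoly]
    ring

open scoped Classical in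
theorem sum_gluesTo (x y z : ℕ) (s : Fin 5) :
    (∑ σ : Fin 6 → Fin 5, if GluesTo gasketCorner outerCorners σ s then
      ∏ i, ![x, y, y, y, z] (σ i) else 0) =
      ![connectedPoly x y z, apartPoly x y z, apartPoly x y z, apartPoly x y z,
        discretePoly x y z] s := by
  have hM : Equivalence (bitRel equalityBits) := by
    rw [bitRel_equalityBits]
    exact eq_equivalence
  have h := sum_leaves s x y z 6 gasketCorner equalityBits 0 0 0 [] hM
  rw [List.map_nil, List.sum_nil, add_zero, show monomial x y z (0, 0, 0) = 1 by simp [monomial],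
    one_mul] at h
  rw [← sum_gasketLeaves, gasketLeaves, h]
  refine Finset.sum_congr rfl fun σ _ => if_congr ?_ rfl rfl
  have : (Relation.EqvGen fun x y => bitRel equalityBits x y ∨ stateRel gasketCorner σ x y) =
      Relation.EqvGen (stateRel gasketCorner σ) := by
    funext u v
    refine propext ⟨Relation.EqvGen.le_of_equivalence (Relation.EqvGen.is_equivalence _) ?_,
      fun h => h.mono fun _ _ => .inr⟩
    rintro u v (h | h)
    · rw [bitRel_equalityBits] at h
      exact h ▸ .refl _
    · exact .rel _ _ h
  rw [this]
  rfl

/-! ### The gasket as a gluing of six copies -/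

namespace SG23

def offset : Fin 6 → ℕ × ℕ := ![(0, 0), (1, 0), (2, 0), (0, 1), (1, 1), (0, 2)]

/-- The translation that moves the stage `n` gasket to its copy `i` in the stage `n + 1` gasket. -/
def shift (n : ℕ) (i : Fin 6) (x : ℕ × ℕ) : ℕ × ℕ :=
  (3 ^ n * (offset i).1 + x.1, 3 ^ n * (offset i).2 + x.2)

theorem mem_triangle {x c : ℕ × ℕ} : x ∈ triangle c ↔
    x.1 = c.1 ∧ x.2 = c.2 ∨ x.1 = c.1 + 1 ∧ x.2 = c.2 ∨ x.1 = c.1 ∧ x.2 = c.2 + 1 := by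
  simp [triangle, Prod.ext_iff]

theorem mem_vertices {n : ℕ} {x : ℕ × ℕ} : x ∈ vertices n ↔ ∃ c ∈ cells n, x ∈ triangle c := by
  simp [vertices]

theorem mem_cells_succ {n : ℕ} {c : ℕ × ℕ} :
    c ∈ cells (n + 1) ↔ ∃ i, ∃ d ∈ cells n, shift n i d = c := by
  have h : ∀ o, o ∈ offsets ↔ ∃ i, offset i = o := fun o => by
    simp [offsets, offset, Fin.exists_fin_succ, eq_comm]
  simp only [cells, Finset.mem_image, Finset.mem_product, h, Prod.exists, shift]
  constructor
  · rintro ⟨a, b, c, d, ⟨⟨i, hi⟩, hcd⟩, rfl⟩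
    exact ⟨i, c, d, hcd, by rw [hi]⟩
  · rintro ⟨i, c, d, hcd, rfl⟩
    exact ⟨(offset i).1, (offset i).2, c, d, ⟨⟨i, rfl⟩, hcd⟩, rfl⟩

theorem mem_triangle_shift {n : ℕ} {i : Fin 6} {y d : ℕ × ℕ} :
    y ∈ triangle (shift n i d) ↔ ∃ x ∈ triangle d, shift n i x = y := by
  constructor
  · intro h
    rw [mem_triangle] at h
    simp only [shift] at h
    refine ⟨(y.1 - 3 ^ n * (offset i).1, y.2 - 3 ^ n * (offset i).2), ?_, ?_⟩
    · rw [mem_triangle]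
      dsimp only
      omega
    · rw [shift, Prod.ext_iff]
      dsimp only
      omega
  · rintro ⟨x, hx, rfl⟩
    rw [mem_triangle] at hx ⊢
    simp only [shift]
    omega

theorem shift_injective (n : ℕ) (i : Fin 6) : Function.Injective (shift n i) := by
  intro x y h
  simp only [shift, Prod.ext_iff] at h
  rw [Prod.ext_iff]
  omega

theorem mem_triangle_shift_shift {n : ℕ} {i : Fin 6} {x d : ℕ × ℕ} :
    shift n i x ∈ triangle (shift n i d) ↔ x ∈ triangle d := by
  rw [mem_triangle_shift]
  exact ⟨fun ⟨y, hy, h⟩ => shift_injective n i h ▸ hy, fun h => ⟨x, h, rfl⟩⟩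

theorem mem_vertices_succ {n : ℕ} {y : ℕ × ℕ} :
    y ∈ vertices (n + 1) ↔ ∃ i, ∃ x ∈ vertices n, shift n i x = y := by
  simp only [mem_vertices, mem_cells_succ]
  constructor
  · rintro ⟨_, ⟨i, d, hd, rfl⟩, hy⟩
    obtain ⟨x, hx, rfl⟩ := mem_triangle_shift.1 hy
    exact ⟨i, x, ⟨d, hd, hx⟩, rfl⟩
  · rintro ⟨i, x, ⟨d, hd, hx⟩, rfl⟩
    exact ⟨_, ⟨i, d, hd, rfl⟩, mem_triangle_shift_shift.2 hx⟩

theorem offset_add_le (i : Fin 6) : (offset i).1 + (offset i).2 ≤ 2 := by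
  fin_cases i <;> simp [offset]

theorem add_le_of_mem_vertices {n : ℕ} : ∀ {x : ℕ × ℕ}, x ∈ vertices n → x.1 + x.2 ≤ 3 ^ n := by
  induction n with
  | zero =>
    intro x hx
    obtain ⟨c, hc, hx⟩ := mem_vertices.1 hx
    obtain rfl : c = (0, 0) := by simpa [cells] using hc
    rw [mem_triangle] at hx
    simp only [pow_zero]
    omega
  | succ n ih =>
    intro x hx
    obtain ⟨i, y, hy, rfl⟩ := mem_vertices_succ.1 hx
    have h₁ := ih hy
    have h₂ := Nat.mul_le_mul_left (3 ^ n) (offset_add_le i)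
    rw [mul_add] at h₂
    rw [pow_succ, shift]
    dsimp only
    omega

/-- Coordinates of the left, right and topmost outmost vertices. -/
def cornerCoord (n : ℕ) : Fin 3 → ℕ × ℕ := ![(0, 0), (3 ^ n, 0), (0, 3 ^ n)]

theorem shift_eq_shift {n : ℕ} {i j : Fin 6} {u v : ℕ × ℕ} (hu : u.1 + u.2 ≤ 3 ^ n)
    (hv : v.1 + v.2 ≤ 3 ^ n) (hij : i ≠ j) (h : shift n i u = shift n j v) :
    (u = cornerCoord n 0 ∨ u = cornerCoord n 1 ∨ u = cornerCoord n 2) ∧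
      ∀ u' v' : ℕ × ℕ, u'.1 + u'.2 ≤ 3 ^ n → v'.1 + v'.2 ≤ 3 ^ n →
        shift n i u' = shift n j v' → u = u' := by
  have hN : 0 < 3 ^ n := by positivity
  simp only [cornerCoord, shift, Prod.ext_iff] at *
  -- Only positivity of the side length matters. With a variable in its place, each of the 30 pairs
  -- of distinct offsets is a linear problem about two translates of the triangle x, y ≥ 0, x + y ≤
  -- N.
  generalize 3 ^ n = N at *
  fin_cases i <;> fin_cases j <;> first | exact absurd rfl hij | skip
  all_goals
    simp only [offset, Fin.mk_one, Fin.zero_eta, Fin.reduceFinMk, Matrix.cons_val, mul_zero,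
      mul_one, zero_add] at *
    refine ⟨by omega, fun u' v' _ _ _ => by omega⟩

def corner (n : ℕ) : Fin 3 → vertices n := ![left n, right n, top n]

theorem coe_corner (n : ℕ) (a : Fin 3) : (corner n a : ℕ × ℕ) = cornerCoord n a := by
  fin_cases a <;> rfl

def embed (n : ℕ) (i : Fin 6) (x : vertices n) : vertices (n + 1) :=
  ⟨shift n i x, mem_vertices_succ.2 ⟨i, x, x.2, rfl⟩⟩

def pointCoord : Fin 10 → ℕ × ℕ :=
  ![(0, 0), (1, 0), (2, 0), (3, 0), (0, 1), (1, 1), (2, 1), (0, 2), (1, 2), (0, 3)]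

theorem shift_cornerCoord (n : ℕ) (i : Fin 6) (a : Fin 3) : shift n i (cornerCoord n a) =
    (3 ^ n * (pointCoord (gasketCorner i a)).1, 3 ^ n * (pointCoord (gasketCorner i a)).2) := by
  have h : ∀ i a, (offset i).1 + (cornerCoord 0 a).1 = (pointCoord (gasketCorner i a)).1 ∧
      (offset i).2 + (cornerCoord 0 a).2 = (pointCoord (gasketCorner i a)).2 := by decide
  have h' : ∀ a, cornerCoord n a = (3 ^ n * (cornerCoord 0 a).1, 3 ^ n * (cornerCoord 0 a).2) := by
    intro a
    fin_cases a <;> simp [cornerCoord]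
  rw [← (h i a).1, ← (h i a).2, shift, h', mul_add, mul_add]

theorem gasketCorner_surjective (q : Fin 10) : ∃ i a, gasketCorner i a = q := by
  revert q
  decide

/-- The ten outmost vertices of the copies of the stage `n` gasket in the stage `n + 1` gasket. -/
def point (n : ℕ) (q : Fin 10) : vertices (n + 1) :=
  ⟨(3 ^ n * (pointCoord q).1, 3 ^ n * (pointCoord q).2), by
    obtain ⟨i, a, rfl⟩ := gasketCorner_surjective q
    rw [← shift_cornerCoord, ← coe_corner]
    exact (embed n i (corner n a)).2⟩

theorem cornerGluing (n : ℕ) :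
    CornerGluing (embed n) (corner n) (point n) gasketCorner where
  inj i x y h := Subtype.ext (shift_injective n i (congrArg Subtype.val h))
  corner i a := Subtype.ext (by
    rw [embed, point]
    dsimp only
    rw [coe_corner, shift_cornerCoord])
  meet {i j u v} hij h := by
    obtain ⟨h, -⟩ := shift_eq_shift (add_le_of_mem_vertices u.2) (add_le_of_mem_vertices v.2) hij
      (congrArg Subtype.val h)
    simp only [← coe_corner] at h
    rcases h with h | h | h
    · exact ⟨0, Subtype.ext h⟩
    · exact ⟨1, Subtype.ext h⟩
    · exact ⟨2, Subtype.ext h⟩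
  meet_unique {i j u v u' v'} hij h h' := by
    obtain ⟨-, h⟩ := shift_eq_shift (add_le_of_mem_vertices u.2) (add_le_of_mem_vertices v.2) hij
      (congrArg Subtype.val h)
    exact Subtype.ext (h u' v' (add_le_of_mem_vertices u'.2) (add_le_of_mem_vertices v'.2)
      (congrArg Subtype.val h'))
  p_inj x y h := by
    have hN : 0 < 3 ^ n := by positivity
    have h' := congrArg Subtype.val h
    simp only [point, Prod.mk.injEq, mul_right_inj' hN.ne'] at h'
    have key : ∀ x y, (pointCoord x).1 = (pointCoord y).1 ∧ (pointCoord x).2 = (pointCoord y).2 →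
        x = y := by decide
    exact key x y h'
  t_surj := gasketCorner_surjective
  cover w := by
    obtain ⟨i, x, hx, h⟩ := mem_vertices_succ.1 w.2
    exact ⟨i, ⟨x, hx⟩, Subtype.ext h⟩

theorem graph_succ (n : ℕ) : graph (n + 1) = CornerGluing.glue (embed n) fun _ => graph n := by
  ext u v
  rw [(cornerGluing n).glue_adj]
  constructor
  · rintro ⟨hne, c, hc, hu, hv⟩
    obtain ⟨i, d, hd, rfl⟩ := mem_cells_succ.1 hc
    obtain ⟨x, hx, hxu⟩ := mem_triangle_shift.1 hu
    obtain ⟨y, hy, hyv⟩ := mem_triangle_shift.1 hv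
    refine ⟨i, ⟨x, mem_vertices.2 ⟨d, hd, hx⟩⟩, ⟨y, mem_vertices.2 ⟨d, hd, hy⟩⟩,
      ⟨fun h => hne ?_, d, hd, hx, hy⟩, Subtype.ext hxu, Subtype.ext hyv⟩
    exact Subtype.ext (hxu.symm.trans ((congrArg (shift n i) (congrArg Subtype.val h)).trans hyv))
  · rintro ⟨i, x, y, ⟨hne, d, hd, hx, hy⟩, rfl, rfl⟩
    exact ⟨fun h => hne ((cornerGluing n).inj i h), shift n i d, mem_cells_succ.2 ⟨i, d, hd, rfl⟩,
      mem_triangle_shift_shift.2 hx, mem_triangle_shift_shift.2 hy⟩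

theorem point_outerCorners (n : ℕ) : point n ∘ outerCorners = corner (n + 1) := by
  funext a
  refine Subtype.ext ?_
  rw [coe_corner]
  fin_cases a <;> simp [point, outerCorners, pointCoord, cornerCoord, pow_succ]

/-- The number of spanning subgraphs of the stage `n` gasket with state `s`. -/
noncomputable def count (n : ℕ) (s : Fin 5) : ℕ := stateCount (graph n) (corner n) s

/-- The three states with two components have the same polynomial, so equality of their counts
propagates from stage to stage without any appeal to the symmetry of the gasket. -/
theorem count_succ {n x y z : ℕ} (h : count n = ![x, y, y, y, z]) :
    count (n + 1) = ![connectedPoly x y z, apartPoly x y z, apartPoly x y z, apartPoly x y z,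
      discretePoly x y z] := by
  classical
  funext s
  rw [count, graph_succ, ← point_outerCorners, (cornerGluing n).stateCount_glue,
    ← sum_gluesTo x y z s, ← h]
  rfl

end SG23

/-! ### Component counts and the initial triangle -/

/-- The map from the representatives to components is injective, so by finiteness having `k`
components amounts to its surjectivity. -/
theorem SimpleGraph.card_connectedComponent_eq_iff {V : Type*} [Finite V] (H : SimpleGraph V)
    {k : ℕ} {c : Fin k → V} (h : ∀ a b, H.Reachable (c a) (c b) → a = b) :
    Nat.card H.ConnectedComponent = k ↔ ∀ u, ∃ a, H.Reachable u (c a) := by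
  have hinj : Function.Injective fun a => H.connectedComponentMk (c a) := fun a b hab =>
    h a b (SimpleGraph.ConnectedComponent.exact hab)
  have hsurj : (∀ u, ∃ a, H.Reachable u (c a)) ↔
      Function.Surjective fun a => H.connectedComponentMk (c a) := by
    constructor
    · intro h x
      induction x using SimpleGraph.ConnectedComponent.ind with
      | _ u =>
        obtain ⟨a, ha⟩ := h u
        exact ⟨a, SimpleGraph.ConnectedComponent.sound ha.symm⟩
    · intro h u
      obtain ⟨a, ha⟩ := h (H.connectedComponentMk u)
      exact ⟨a, (SimpleGraph.ConnectedComponent.exact ha).symm⟩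
  rw [hsurj]
  constructor
  · intro hk
    exact (hinj.bijective_of_nat_card_le (by rw [hk, Nat.card_fin])).2
  · intro hs
    rw [← Nat.card_eq_of_bijective _ ⟨hinj, hs⟩, Nat.card_fin]

section Triangle

variable {V : Type*} {c : Fin 3 ≃ V}

/-- The graph on three vertices whose edge opposite to `k` is present if `S k` holds. -/
def triangleGraph (c : Fin 3 ≃ V) (S : Fin 3 → Bool) : SimpleGraph V where
  Adj u v := u ≠ v ∧ S (-(c.symm u + c.symm v)) = true
  symm := ⟨fun u v h => ⟨h.1.symm, by rw [add_comm]; exact h.2⟩⟩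
  loopless := ⟨fun _ h => h.1 rfl⟩

theorem triangleGraph_adj (S : Fin 3 → Bool) (a b : Fin 3) :
    (triangleGraph c S).Adj (c a) (c b) ↔ a ≠ b ∧ S (-(a + b)) = true := by
  simp [triangleGraph]

theorem triangleGraph_injective : Function.Injective (triangleGraph c) := by
  intro S S' h
  funext k
  -- Modulo 3 the three corners add up to 0, so the corner opposite to the edge `a b` is `-(a + b)`.
  have h' : ∀ k : Fin 3, k + 1 ≠ k + 2 ∧ -(k + 1 + (k + 2)) = k := by decide
  have := triangleGraph_adj (c := c) S (k + 1) (k + 2)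
  rw [h, triangleGraph_adj, (h' k).2, and_iff_right (h' k).1, and_iff_right (h' k).1] at this
  exact (Bool.eq_iff_iff.2 this).symm

theorem triangleGraph_surjective (H : SimpleGraph V) : ∃ S, triangleGraph c S = H := by
  classical
  refine ⟨fun k => decide (H.Adj (c (k + 1)) (c (k + 2))), ?_⟩
  ext u v
  obtain ⟨a, rfl⟩ := c.surjective u
  obtain ⟨b, rfl⟩ := c.surjective v
  rw [triangleGraph_adj, decide_eq_true_iff]
  have h : ∀ a b : Fin 3, a ≠ b → -(a + b) + 1 = a ∧ -(a + b) + 2 = b ∨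
      -(a + b) + 1 = b ∧ -(a + b) + 2 = a := by decide
  by_cases hab : a = b
  · simp [hab]
  · rcases h a b hab with ⟨h₁, h₂⟩ | ⟨h₁, h₂⟩
    · rw [h₁, h₂, and_iff_right hab]
    · rw [h₁, h₂, and_iff_right hab, SimpleGraph.adj_comm]

/-- The edges opposite to the elements of `S` generate the partition `s` of the corners. -/
def EdgesHaveState (S : Fin 3 → Bool) (s : Fin 5) : Prop :=
  (∀ a b, a ≠ b ∧ S (-(a + b)) = true → cornerLabel s a = cornerLabel s b) ∧
    ∀ a b, cornerLabel s a = cornerLabel s b → a = b ∨ (a ≠ b ∧ S (-(a + b)) = true) ∨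
      ∃ d, (a ≠ d ∧ S (-(a + d)) = true) ∧ d ≠ b ∧ S (-(d + b)) = true

instance (S : Fin 3 → Bool) (s : Fin 5) : Decidable (EdgesHaveState S s) := by
  unfold EdgesHaveState
  infer_instance

theorem EdgesHaveState.hasState {S : Fin 3 → Bool} {s : Fin 5} (h : EdgesHaveState S s) :
    HasState c s (triangleGraph c S) := by
  refine ⟨fun u => ⟨c.symm u, by rw [c.apply_symm_apply]⟩, fun a b => ⟨fun hab => ?_, fun hab => ?_⟩⟩
  · have key : ∀ w, Relation.ReflTransGen (triangleGraph c S).Adj (c a) w →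
        cornerLabel s a = cornerLabel s (c.symm w) := by
      intro w hw
      induction hw with
      | refl => rw [c.symm_apply_apply]
      | @tail v w _ hvw ih =>
        obtain ⟨i, rfl⟩ := c.surjective v
        obtain ⟨j, rfl⟩ := c.surjective w
        rw [ih, c.symm_apply_apply, c.symm_apply_apply]
        exact h.1 i j ((triangleGraph_adj S i j).1 hvw)
    simpa using key _ ((SimpleGraph.reachable_iff_reflTransGen _ _).1 hab)
  · rcases h.2 a b hab with rfl | hab | ⟨d, h₁, h₂⟩
    · exact .refl _
    · exact ((triangleGraph_adj S a b).2 hab).reachable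
    · exact ((triangleGraph_adj S a d).2 h₁).reachable.trans
        ((triangleGraph_adj S d b).2 h₂).reachable

/-- Of the eight subgraphs of a triangle, the four with at least two edges are connected, each
single edge gives one of the partitions into two blocks, and the empty graph gives the discrete one.
-/
theorem stateCount_top (c : Fin 3 ≃ V) : stateCount (⊤ : SimpleGraph V) c = ![4, 1, 1, 1, 1] := by
  funext s
  have hex : ∀ S, ∃ s, EdgesHaveState S s := by decide
  have hiff : ∀ S, HasState c s (triangleGraph c S) ↔ EdgesHaveState S s := fun S => by
    refine ⟨fun h => ?_, fun h => h.hasState⟩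
    obtain ⟨s', hs'⟩ := hex S
    rwa [h.unique (hs'.hasState (c := c))]
  have hset : {H : SimpleGraph V | H ≤ ⊤ ∧ HasState c s H} =
      triangleGraph c '' (({S | EdgesHaveState S s} : Finset (Fin 3 → Bool)) :
        Set (Fin 3 → Bool)) := by
    ext H
    obtain ⟨S, rfl⟩ := triangleGraph_surjective (c := c) H
    simp [triangleGraph_injective.eq_iff, hiff]
  rw [stateCount, hset, Set.ncard_image_of_injective _ triangleGraph_injective,
    Set.ncard_coe_finset]
  have key : ∀ s, ({S | EdgesHaveState S s} : Finset (Fin 3 → Bool)).card =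
      (![4, 1, 1, 1, 1] : Fin 5 → ℕ) s := by decide
  exact key s

end Triangle

/-! ### The number of vertices, and `f`, `g`, `h` as state counts -/

/-- Away from the corners the images of the copies are disjoint, and they exhaust the vertices that
are not glued corners. -/
theorem CornerGluing.card_eq {V W ι κ τ : Type*} [Fintype V] [Fintype W] [Fintype ι] [Fintype κ]
    [Fintype τ] {e : ι → V → W} {c : κ → V} {p : τ → W} {t : ι → κ → τ}
    (hG : CornerGluing e c p t) (hc : Function.Injective c) :
    Fintype.card W =
      Fintype.card τ + Fintype.card ι * (Fintype.card V - Fintype.card κ) := by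
  classical
  let φ : ι × {v // v ∉ Set.range c} → {w // w ∉ Set.range p} := fun x => ⟨e x.1 x.2, by
    rintro ⟨q, hq⟩
    obtain ⟨a, ha, -⟩ := hG.exists_corner hq.symm
    exact x.2.2 ⟨a, ha.symm⟩⟩
  have hφ : Function.Bijective φ := by
    constructor
    · rintro ⟨i, u, hu⟩ ⟨j, v, hv⟩ h
      have h' : e i u = e j v := congrArg Subtype.val h
      by_cases hij : i = j
      · subst hij
        obtain rfl := hG.inj _ h'
        rfl
      · obtain ⟨a, rfl⟩ := hG.meet hij h'
        exact absurd ⟨a, rfl⟩ hu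
    · rintro ⟨w, hw⟩
      obtain ⟨i, u, rfl⟩ := hG.cover w
      refine ⟨⟨i, u, ?_⟩, rfl⟩
      rintro ⟨a, rfl⟩
      exact hw ⟨t i a, (hG.corner i a).symm⟩
  have h₁ := Fintype.card_of_bijective hφ
  have h₂ := Fintype.card_congr (Equiv.ofInjective c hc)
  have h₃ := Fintype.card_congr (Equiv.ofInjective p hG.p_inj)
  have h₄ := Fintype.card_subtype_compl fun v => v ∈ Set.range c
  have h₅ := Fintype.card_subtype_compl fun w => w ∈ Set.range p
  have h₆ := Fintype.card_subtype_le fun w => w ∈ Set.range p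
  rw [Fintype.card_prod] at h₁
  change Fintype.card κ = Fintype.card {v // v ∈ Set.range c} at h₂
  change Fintype.card τ = Fintype.card {w // w ∈ Set.range p} at h₃
  rw [h₂, h₃, ← h₄, h₁, h₅]
  omega

namespace SG23

theorem corner_injective (n : ℕ) : Function.Injective (corner n) := by
  have hN : 3 ^ n ≠ 0 := by positivity
  intro a b h
  have h' := congrArg Subtype.val h
  rw [coe_corner, coe_corner] at h'
  simp only [cornerCoord] at h'
  generalize 3 ^ n = N at hN h'
  fin_cases a <;> fin_cases b <;> first | rfl | skip
  all_goals
    simp only [Fin.mk_one, Fin.zero_eta, Fin.reduceFinMk, Matrix.cons_val, Prod.mk.injEq] at h'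
    omega

theorem card_vertices (n : ℕ) : 5 * Fintype.card (vertices n) = 7 * 6 ^ n + 8 := by
  induction n with
  | zero => decide
  | succ n ih =>
    have h := (cornerGluing n).card_eq (corner_injective n)
    -- There are at least three vertices, so the truncated subtraction is genuine and the recursion
    -- is v(n+1) = 6 v(n) - 8.
    have h3 := Fintype.card_le_of_injective _ (corner_injective n)
    simp only [Fintype.card_fin] at h h3
    rw [pow_succ]
    omega

theorem f_eq_count (n : ℕ) : f n = count n 0 := by
  refine congrArg Set.ncard (Set.ext fun H => and_congr_right fun _ => ?_)
  have hlabel : ∀ a b, cornerLabel 0 a = cornerLabel 0 b := by decide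
  constructor
  · intro h
    exact ⟨fun u => ⟨0, h.preconnected _ _⟩, fun a b => iff_of_true (h.preconnected _ _) (hlabel a b)⟩
  · rintro ⟨h₁, h₂⟩
    have h₃ : ∀ u, H.Reachable u (corner n 0) := fun u => by
      obtain ⟨a, ha⟩ := h₁ u
      exact ha.trans ((h₂ a 0).2 (hlabel a 0))
    have : Nonempty (vertices n) := ⟨corner n 0⟩
    exact ⟨fun u v => (h₃ u).trans (h₃ v).symm⟩

theorem g_eq_count (n : ℕ) : g n = count n 1 := by
  refine congrArg Set.ncard (Set.ext fun H => and_congr_right fun _ => ?_)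
  have h0 : corner n 0 = left n := rfl
  have h1 : corner n 1 = right n := rfl
  have h2 : corner n 2 = top n := rfl
  have hcard : ¬ H.Reachable (top n) (left n) → (Nat.card H.ConnectedComponent = 2 ↔
      ∀ u, ∃ a, H.Reachable u (![left n, top n] a)) := fun h =>
    H.card_connectedComponent_eq_iff fun a b hab => by
      fin_cases a <;> fin_cases b <;> first | rfl | skip
      · exact absurd (SimpleGraph.Reachable.symm hab) h
      · exact absurd hab h
  constructor
  · rintro ⟨h₁, h₂, h₃⟩
    refine ⟨fun u => ?_, ?_⟩
    · obtain ⟨a, ha⟩ := (hcard h₃).1 h₁ u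
      fin_cases a
      · exact ⟨0, ha⟩
      · exact ⟨2, ha⟩
    · have h₄ : ¬ H.Reachable (top n) (right n) := fun h => h₃ (h.trans h₂.symm)
      have h₅ : ¬ H.Reachable (left n) (top n) := fun h => h₃ h.symm
      have h₆ : ¬ H.Reachable (right n) (top n) := fun h => h₄ h.symm
      simp [Fin.forall_fin_succ, cornerLabel, h0, h1, h2, h₂, h₂.symm, h₃, h₄, h₅, h₆]
  · rintro ⟨h₁, h₂⟩
    have h₃ : H.Reachable (left n) (right n) := (h₂ 0 1).2 rfl
    have h₄ : ¬ H.Reachable (top n) (left n) := fun h => absurd ((h₂ 2 0).1 h) (by decide)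
    refine ⟨(hcard h₄).2 fun u => ?_, h₃, h₄⟩
    obtain ⟨a, ha⟩ := h₁ u
    fin_cases a
    · exact ⟨0, ha⟩
    · exact ⟨0, ha.trans h₃.symm⟩
    · exact ⟨1, ha⟩

theorem h_eq_count (n : ℕ) : h n = count n 4 := by
  refine congrArg Set.ncard (Set.ext fun H => and_congr_right fun _ => ?_)
  have hlabel : ∀ a b, cornerLabel 4 a = cornerLabel 4 b ↔ a = b := by decide
  have hinj : (∀ a b, H.Reachable (corner n a) (corner n b) → a = b) →
      (Nat.card H.ConnectedComponent = 3 ↔ ∀ u, ∃ a, H.Reachable u (corner n a)) :=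
    H.card_connectedComponent_eq_iff
  constructor
  · rintro ⟨h₁, h₂, h₃, h₄⟩
    have h₅ : ∀ a b, H.Reachable (corner n a) (corner n b) → a = b := by
      intro a b hab
      fin_cases a <;> fin_cases b <;>
        first
          | rfl
          | exact absurd hab h₂ | exact absurd hab.symm h₂
          | exact absurd hab h₃ | exact absurd hab.symm h₃
          | exact absurd hab h₄ | exact absurd hab.symm h₄
    exact ⟨(hinj h₅).1 h₁, fun a b => ⟨fun h => (hlabel a b).2 (h₅ a b h),
      fun h => (hlabel a b).1 h ▸ .refl _⟩⟩
  · rintro ⟨h₁, h₂⟩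
    exact ⟨(hinj fun a b h => (hlabel a b).1 ((h₂ a b).1 h)).2 h₁,
      fun h => absurd ((h₂ 0 1).1 h) (by decide), fun h => absurd ((h₂ 2 0).1 h) (by decide),
      fun h => absurd ((h₂ 2 1).1 h) (by decide)⟩

theorem count_zero : count 0 = ![4, 1, 1, 1, 1] := by
  have hb : Function.Bijective (corner 0) :=
    (Fintype.bijective_iff_injective_and_card _).2 ⟨corner_injective 0, by decide⟩
  have hg : graph 0 = ⊤ := by
    ext u v
    rw [SimpleGraph.top_adj]
    refine ⟨fun h => h.1, fun h => ⟨h, (0, 0), by simp [cells], ?_, ?_⟩⟩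
    · obtain ⟨c, hc, hu⟩ := mem_vertices.1 u.2
      rwa [Finset.mem_singleton.1 hc] at hu
    · obtain ⟨c, hc, hu⟩ := mem_vertices.1 v.2
      rwa [Finset.mem_singleton.1 hc] at hu
  have := stateCount_top (Equiv.ofBijective _ hb)
  rw [← hg] at this
  exact this

theorem count_eq (n : ℕ) : count n = ![f n, g n, g n, g n, h n] := by
  have key : ∃ x y z, count n = ![x, y, y, y, z] := by
    induction n with
    | zero => exact ⟨4, 1, 1, count_zero⟩
    | succ n ih =>
      obtain ⟨x, y, z, hxyz⟩ := ih
      exact ⟨_, _, _, count_succ hxyz⟩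
  obtain ⟨x, y, z, hxyz⟩ := key
  rw [f_eq_count, g_eq_count, h_eq_count, hxyz]
  rfl

theorem f_zero : f 0 = 4 := by rw [f_eq_count, count_zero]; rfl

theorem g_zero : g 0 = 1 := by rw [g_eq_count, count_zero]; rfl

theorem h_zero : h 0 = 1 := by rw [h_eq_count, count_zero]; rfl

theorem f_succ (n : ℕ) : f (n + 1) = connectedPoly (f n) (g n) (h n) := by
  rw [f_eq_count (n + 1), count_succ (count_eq n)]
  rfl

theorem g_succ (n : ℕ) : g (n + 1) = apartPoly (f n) (g n) (h n) := by
  rw [g_eq_count (n + 1), count_succ (count_eq n)]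
  rfl

theorem h_succ (n : ℕ) : h (n + 1) = discretePoly (f n) (g n) (h n) := by
  rw [h_eq_count (n + 1), count_succ (count_eq n)]
  rfl

end SG23

/-! ### The recursion for `α` and `ρ` -/

namespace SG23

section Polynomials

def stepP (a r : ℝ) : ℝ := 142 + 18 * r + 78 * a + 3 * (a * r) + 15 * a ^ 2 + a ^ 3

def stepQ (a r : ℝ) : ℝ :=
  171 + 77 * r + 2 * r ^ 2 + 89 * a + 18 * (a * r) + 16 * a ^ 2 + a ^ 2 * r + a ^ 3

def stepR (a r : ℝ) : ℝ :=
  468 + 564 * r + 279 * a + 60 * r ^ 2 + 129 * (a * r) + 51 * a ^ 2 + 3 * (a * r ^ 2) +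
    6 * (a ^ 2 * r) + 3 * a ^ 3

theorem stepP_pos {a r : ℝ} (ha : 0 < a) (hr : 0 < r) : 0 < stepP a r := by
  unfold stepP
  positivity

theorem stepQ_pos {a r : ℝ} (ha : 0 < a) (hr : 0 < r) : 0 < stepQ a r := by
  unfold stepQ
  positivity

theorem stepP_mono {a b r s : ℝ} (ha : 0 ≤ a) (hr : 0 ≤ r) (hab : a ≤ b) (hrs : r ≤ s) :
    stepP a r ≤ stepP b s := by
  unfold stepP
  have := ha.trans hab
  gcongr

theorem stepQ_mono {a b r s : ℝ} (ha : 0 ≤ a) (hr : 0 ≤ r) (hab : a ≤ b) (hrs : r ≤ s) :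
    stepQ a r ≤ stepQ b s := by
  unfold stepQ
  have := ha.trans hab
  gcongr

theorem stepR_mono {a b r s : ℝ} (ha : 0 ≤ a) (hr : 0 ≤ r) (hab : a ≤ b) (hrs : r ≤ s) :
    stepR a r ≤ stepR b s := by
  unfold stepR
  have := ha.trans hab
  gcongr

theorem stepP_le_stepQ {a r : ℝ} (ha : 0 ≤ a) (hr : 0 ≤ r) : stepP a r ≤ stepQ a r := by
  unfold stepP stepQ
  have : 0 ≤ a * r := by positivity
  have : 0 ≤ a ^ 2 * r := by positivity
  nlinarith

/-- A crude bound suffices: `α` loses at most a factor 5 per step, so its logarithm is at least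
linear in n with slope -ln 5, negligible against 6 ^ n. -/
theorem stepQ_le_stepP {a r : ℝ} (ha : 0 ≤ a) (hr : 0 ≤ r) (hr' : r ≤ 4) :
    stepQ a r ≤ 5 * stepP a r := by
  unfold stepP stepQ
  have h₁ : a * r ≤ a * 4 := by gcongr
  have h₂ : a ^ 2 * r ≤ a ^ 2 * 4 := by gcongr
  have h₃ : r ^ 2 ≤ r * 4 := by rw [sq]; gcongr
  have h₄ : 0 ≤ a ^ 2 := by positivity
  have h₅ : 0 ≤ a ^ 3 := by positivity
  have h₆ : 0 ≤ a * r := by positivity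
  linarith

/-- Equality holds at a = 0, r = 3, where 3 · 420² = 196 · 2700. After the substitution r = 3 + s,
negative terms such as -411 s² are absorbed by lower powers of s, using s ≤ 1. -/
theorem three_mul_sq_le {a r : ℝ} (ha : 0 ≤ a) (hr : 3 ≤ r) (hr' : r ≤ 4) :
    3 * stepQ a r ^ 2 ≤ stepP a r * stepR a r := by
  obtain ⟨s, rfl⟩ : ∃ s, r = 3 + s := ⟨r - 3, by ring⟩
  have hs : 0 ≤ s := by linarith
  have hs' : s ≤ 1 := by linarith
  have low : ∀ i j, 0 ≤ a ^ i * s ^ j := fun i j => by positivity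
  have pow : ∀ i j k, k = j + 1 → a ^ i * s ^ k ≤ a ^ i * s ^ j := fun i j k hk =>
    mul_le_mul_of_nonneg_left (pow_le_pow_of_le_one hs hs' (by omega)) (by positivity)
  unfold stepP stepQ stepR
  linarith [low 0 1, low 0 3, low 1 0, low 1 1, low 1 3, low 2 0, low 2 1, low 3 0, low 3 1,
    low 3 2, low 4 0, low 4 1, pow 0 1 2 rfl, pow 0 2 3 rfl, pow 0 3 4 rfl, pow 1 1 2 rfl,
    pow 2 1 2 rfl, pow 2 2 3 rfl]

/-- This is the step α' ≤ 15 (ρ' - 3) of the invariant, with denominators cleared. The left side has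
degree 7 in a, while the terms in a⁶ cancel on the right, so an upper bound for a is needed; it
serves to lower the high powers. -/
theorem mul_stepP_mul_stepQ_le {a r : ℝ} (ha : 0 ≤ a) (ha' : a ≤ 13 / 10) (hr : 3 ≤ r)
    (hr' : r ≤ 4) :
    a * stepP a r * stepQ a r ≤ 15 * (stepP a r * stepR a r - 3 * stepQ a r ^ 2) := by
  obtain ⟨s, rfl⟩ : ∃ s, r = 3 + s := ⟨r - 3, by ring⟩
  have hs : 0 ≤ s := by linarith
  have hs' : s ≤ 1 := by linarith
  have low : ∀ i j, 0 ≤ a ^ i * s ^ j := fun i j => by positivity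
  have pow : ∀ i j k, k = j + 1 → a ^ i * s ^ k ≤ a ^ i * s ^ j := fun i j k hk =>
    mul_le_mul_of_nonneg_left (pow_le_pow_of_le_one hs hs' (by omega)) (by positivity)
  have pow' : ∀ i j k, k = i + 1 → a ^ k * s ^ j ≤ 13 / 10 * (a ^ i * s ^ j) := fun i j k hk => by
    rw [hk, pow_succ', mul_assoc]
    exact mul_le_mul_of_nonneg_right ha' (low i j)
  unfold stepP stepQ stepR
  linarith [low 0 1, low 0 2, low 0 3, low 0 4, low 1 0, low 1 1, low 1 2, low 1 3, low 2 0,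
    low 2 1, low 2 2, low 2 3, low 3 0, low 3 1, low 4 0,
    pow 0 1 2 rfl, pow 0 2 3 rfl, pow 0 3 4 rfl, pow 1 1 2 rfl, pow 2 1 2 rfl, pow 2 2 3 rfl,
    pow 3 1 2 rfl, pow 4 1 2 rfl, pow' 1 0 2 rfl, pow' 2 0 3 rfl, pow' 3 0 4 rfl, pow' 4 0 5 rfl,
    pow' 5 0 6 rfl, pow' 6 0 7 rfl, pow' 1 1 2 rfl, pow' 2 1 3 rfl, pow' 3 1 4 rfl,
    pow' 4 1 5 rfl, pow' 5 1 6 rfl]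

/-- To first order at (0, 3), PR - 3Q² is 10368 a + 5424 s with s = r - 3, and Q² is 420². A
decrease of ρ thus requires a to be at most about 16.49 s, which leaves room for the constant 15. -/
theorem stepP_mul_stepR_le {a r : ℝ} (ha : 0 ≤ a) (hr : 3 ≤ r) (har : a ≤ 15 * (r - 3)) :
    stepP a r * stepR a r ≤ r * stepQ a r ^ 2 := by
  obtain ⟨s, rfl⟩ : ∃ s, r = 3 + s := ⟨r - 3, by ring⟩
  have hs : 0 ≤ s := by linarith
  have has : a ≤ 15 * s := by linarith
  have low : ∀ i j, 0 ≤ a ^ i * s ^ j := fun i j => by positivity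
  have pow : ∀ i k, k = i + 1 → a ^ k ≤ 15 * (a ^ i * s) := fun i k hk => by
    rw [hk, pow_succ]
    linarith [mul_le_mul_of_nonneg_left has (pow_nonneg ha i)]
  unfold stepP stepQ stepR
  linarith [low 0 1, low 0 2, low 0 3, low 0 4, low 0 5, low 1 1, low 1 2, low 1 3, low 1 4,
    low 2 1, low 2 2, low 2 3, low 2 4, low 3 1, low 3 2, low 3 3, low 4 1, low 4 2, low 4 3,
    low 5 1, low 5 2, low 6 1, pow 0 1 rfl,
    pow 1 2 rfl, pow 2 3 rfl, pow 3 4 rfl]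

end Polynomials

theorem f_g_h_pos (n : ℕ) : 0 < f n ∧ 0 < g n ∧ 0 < h n := by
  induction n with
  | zero => simp [f_zero, g_zero, h_zero]
  | succ n ih =>
    obtain ⟨hf, hg, hh⟩ := ih
    rw [f_succ, g_succ, h_succ, connectedPoly, apartPoly, discretePoly]
    refine ⟨?_, ?_, ?_⟩ <;> positivity

theorem f_pos (n : ℕ) : 0 < (f n : ℝ) := Nat.cast_pos.2 (f_g_h_pos n).1

theorem g_pos (n : ℕ) : 0 < (g n : ℝ) := Nat.cast_pos.2 (f_g_h_pos n).2.1

theorem h_pos (n : ℕ) : 0 < (h n : ℝ) := Nat.cast_pos.2 (f_g_h_pos n).2.2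

/-- The quotient of `α n` and `β n`. -/
noncomputable def ρ (n : ℕ) : ℝ := α n / β n

theorem α_pos (n : ℕ) : 0 < α n := div_pos (f_pos n) (g_pos n)

theorem β_pos (n : ℕ) : 0 < β n := div_pos (g_pos n) (h_pos n)

theorem ρ_pos (n : ℕ) : 0 < ρ n := div_pos (α_pos n) (β_pos n)

theorem P_eq (n : ℕ) : P n = stepP (α n) (ρ n) := by
  rw [P, stepP, ρ]
  ring

theorem Q_eq (n : ℕ) : Q n = stepQ (α n) (ρ n) := by
  rw [Q, stepQ, ρ]
  ring

theorem P_pos (n : ℕ) : 0 < P n := P_eq n ▸ stepP_pos (α_pos n) (ρ_pos n)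

theorem Q_pos (n : ℕ) : 0 < Q n := Q_eq n ▸ stepQ_pos (α_pos n) (ρ_pos n)

theorem ρ_eq (n : ℕ) : ρ n = f n * h n / g n ^ 2 := by
  have := (g_pos n).ne'
  have := (h_pos n).ne'
  rw [ρ, α, β]
  field_simp

theorem f_succ_eq (n : ℕ) : (f (n + 1) : ℝ) = f n ^ 3 * g n ^ 3 * P n := by
  have := (g_pos n).ne'
  have := (h_pos n).ne'
  rw [f_succ, connectedPoly, P_eq, stepP, ρ_eq, α]
  push_cast
  field_simp

theorem g_succ_eq (n : ℕ) : (g (n + 1) : ℝ) = f n ^ 2 * g n ^ 4 * Q n := by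
  have := (g_pos n).ne'
  have := (h_pos n).ne'
  rw [g_succ, apartPoly, Q_eq, stepQ, ρ_eq, α]
  push_cast
  field_simp
  ring

theorem h_succ_eq (n : ℕ) : (h (n + 1) : ℝ) = f n * g n ^ 5 * stepR (α n) (ρ n) := by
  have := (g_pos n).ne'
  have := (h_pos n).ne'
  rw [h_succ, discretePoly, stepR, ρ_eq, α]
  push_cast
  field_simp

theorem α_zero : α 0 = 4 := by simp [α, f_zero, g_zero]

theorem ρ_zero : ρ 0 = 4 := by simp [ρ_eq, f_zero, g_zero, h_zero]

theorem α_succ (n : ℕ) : α (n + 1) = α n * P n / Q n := by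
  have := (g_pos n).ne'
  have := (f_pos n).ne'
  have := (Q_pos n).ne'
  rw [α, f_succ_eq, g_succ_eq, α]
  field_simp

theorem ρ_succ (n : ℕ) : ρ (n + 1) = P n * stepR (α n) (ρ n) / Q n ^ 2 := by
  have := (g_pos n).ne'
  have := (f_pos n).ne'
  have := (Q_pos n).ne'
  rw [ρ_eq, f_succ_eq, g_succ_eq, h_succ_eq]
  field_simp

theorem α_succ_le (n : ℕ) : α (n + 1) ≤ α n := by
  rw [α_succ, div_le_iff₀ (Q_pos n), P_eq, Q_eq]
  exact mul_le_mul_of_nonneg_left (stepP_le_stepQ (α_pos n).le (ρ_pos n).le) (α_pos n).le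

theorem α_antitone : Antitone α := antitone_nat_of_succ_le α_succ_le

theorem three_le_ρ_succ {n : ℕ} (h₁ : 3 ≤ ρ n) (h₂ : ρ n ≤ 4) : 3 ≤ ρ (n + 1) := by
  rw [ρ_succ, le_div_iff₀ (pow_pos (Q_pos n) 2), P_eq, Q_eq]
  exact three_mul_sq_le (α_pos n).le h₁ h₂

theorem ρ_succ_le {n : ℕ} (h₁ : 3 ≤ ρ n) (h₂ : α n ≤ 15 * (ρ n - 3)) : ρ (n + 1) ≤ ρ n := by
  rw [ρ_succ, div_le_iff₀ (pow_pos (Q_pos n) 2), P_eq, Q_eq]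
  exact stepP_mul_stepR_le (α_pos n).le h₁ h₂

theorem α_succ_le_mul {n : ℕ} (h₁ : 3 ≤ ρ n) (h₂ : ρ n ≤ 4) (h₃ : α n ≤ 13 / 10) :
    α (n + 1) ≤ 15 * (ρ (n + 1) - 3) := by
  have := (Q_pos n).ne'
  have h := mul_stepP_mul_stepQ_le (α_pos n).le h₃ h₁ h₂
  rw [← P_eq, ← Q_eq] at h
  have e₁ : α (n + 1) = α n * P n * Q n / Q n ^ 2 := by
    rw [α_succ]
    field_simp
  have e₂ : 15 * (ρ (n + 1) - 3) =
      15 * (P n * stepR (α n) (ρ n) - 3 * Q n ^ 2) / Q n ^ 2 := by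
    rw [ρ_succ]
    field_simp
  rw [e₁, e₂]
  exact div_le_div_of_nonneg_right h (sq_nonneg _)

/-- One step of the recursion for `α` and `ρ`, in terms of lower and upper bounds. -/
theorem bounds_succ {n : ℕ} {a b r s a' b' r' s' : ℝ} (ha : 0 < a) (hr : 0 < r)
    (hα : a ≤ α n ∧ α n ≤ b) (hρ : r ≤ ρ n ∧ ρ n ≤ s) (h₁ : a' * stepQ b s ≤ a * stepP a r)
    (h₂ : b * stepP b s ≤ b' * stepQ a r) (h₃ : r' * stepQ b s ^ 2 ≤ stepP a r * stepR a r)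
    (h₄ : stepP b s * stepR b s ≤ s' * stepQ a r ^ 2) (ha' : 0 < a') (hr' : 0 < r') :
    (a' ≤ α (n + 1) ∧ α (n + 1) ≤ b') ∧ r' ≤ ρ (n + 1) ∧ ρ (n + 1) ≤ s' := by
  have hb : 0 < b := ha.trans_le (hα.1.trans hα.2)
  have hs : 0 < s := hr.trans_le (hρ.1.trans hρ.2)
  have hP₁ : stepP a r ≤ P n := P_eq n ▸ stepP_mono ha.le hr.le hα.1 hρ.1
  have hP₂ : P n ≤ stepP b s := P_eq n ▸ stepP_mono (α_pos n).le (ρ_pos n).le hα.2 hρ.2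
  have hQ₁ : stepQ a r ≤ Q n := Q_eq n ▸ stepQ_mono ha.le hr.le hα.1 hρ.1
  have hQ₂ : Q n ≤ stepQ b s := Q_eq n ▸ stepQ_mono (α_pos n).le (ρ_pos n).le hα.2 hρ.2
  have hR₁ := stepR_mono ha.le hr.le hα.1 hρ.1
  have hR₂ := stepR_mono (α_pos n).le (ρ_pos n).le hα.2 hρ.2
  have hP := P_pos n
  have hQ := Q_pos n
  have hP' := stepP_pos ha hr
  have hQ' := stepQ_pos ha hr
  have hRa : 0 ≤ stepR a r := by
    unfold stepR
    positivity
  have hR : 0 ≤ stepR (α n) (ρ n) := hRa.trans hR₁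
  have hα' := α_pos n
  have hb' : 0 < b' := by
    by_contra hneg
    have : 0 < b * stepP b s := mul_pos hb (hP.trans_le hP₂)
    nlinarith
  have hs' : 0 ≤ s' := by
    by_contra hneg
    have h : 0 ≤ stepP b s * stepR b s := mul_nonneg (hP.trans_le hP₂).le (hR.trans hR₂)
    have : 0 < stepQ a r ^ 2 := by positivity
    nlinarith
  rw [α_succ, ρ_succ, le_div_iff₀ hQ, div_le_iff₀ hQ, le_div_iff₀ (by positivity),
    div_le_iff₀ (by positivity)]
  refine ⟨⟨?_, ?_⟩, ?_, ?_⟩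
  · calc a' * Q n ≤ a' * stepQ b s := by gcongr
      _ ≤ a * stepP a r := h₁
      _ ≤ α n * P n := by
        have := hα.1
        gcongr
  · calc α n * P n ≤ b * stepP b s := by
          have := hα.2
          gcongr
      _ ≤ b' * stepQ a r := h₂
      _ ≤ b' * Q n := by gcongr
  · calc r' * Q n ^ 2 ≤ r' * stepQ b s ^ 2 := by gcongr
      _ ≤ stepP a r * stepR a r := h₃
      _ ≤ P n * stepR (α n) (ρ n) := by gcongr
  · calc P n * stepR (α n) (ρ n) ≤ stepP b s * stepR b s := by
          have := hP.trans_le hP₂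
          gcongr
      _ ≤ s' * stepQ a r ^ 2 := h₄
      _ ≤ s' * Q n ^ 2 := by gcongr

end SG23

/-! ### Numerical bounds -/

namespace SG23

/-- The series is that of ln ((1 + t) / (1 - t)). Splitting off a power of 2 keeps t at most 1/3,
where the remainder after 14 terms is below 4 · 10⁻¹⁴. -/
theorem two_pow_mul_le_log {x t q K : ℝ} (k : ℕ) (hK : K = k) (ht : 0 ≤ t) (ht' : t < 1)
    (hx : 2 ^ k * (1 + t) ≤ x * (1 - t))
    (hq : q ≤ 2 * ∑ i ∈ Finset.range 14, t ^ (2 * i + 1) / (2 * i + 1)) :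
    K * Real.log 2 + q ≤ Real.log x := by
  have h₁ : 0 < 1 - t := by linarith
  have h₂ : 2 ^ k * ((1 + t) / (1 - t)) ≤ x := by
    rw [← mul_div_assoc, div_le_iff₀ h₁]
    exact hx
  have h₃ : 0 < (1 + t) / (1 - t) := by positivity
  have h₄ := Real.log_le_log (by positivity) h₂
  rw [Real.log_mul (by positivity) h₃.ne', Real.log_pow, ← hK] at h₄
  have h₅ := Real.sum_range_le_log_div ht ht' 14
  linarith

theorem log_le_two_pow_mul {x t q K : ℝ} (k : ℕ) (hK : K = k) (ht : 0 ≤ t) (ht' : t < 1)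
    (hx₀ : 0 < x) (hx : x * (1 - t) ≤ 2 ^ k * (1 + t))
    (hq : 2 * (∑ i ∈ Finset.range 14, t ^ (2 * i + 1) / (2 * i + 1)) +
      2 * (t ^ 29 / (1 - t ^ 2)) ≤ q) :
    Real.log x ≤ K * Real.log 2 + q := by
  have h₁ : 0 < 1 - t := by linarith
  have h₂ : x ≤ 2 ^ k * ((1 + t) / (1 - t)) := by
    rw [← mul_div_assoc, le_div_iff₀ h₁]
    exact hx
  have h₃ : 0 < (1 + t) / (1 - t) := by positivity
  have h₄ := Real.log_le_log hx₀ h₂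
  rw [Real.log_mul (by positivity) h₃.ne', Real.log_pow, ← hK] at h₄
  have h₅ := Real.log_div_le_sum_range_add ht ht' 14
  norm_num only at h₅
  linarith

theorem log_P_bounds {n : ℕ} {a b r s K₁ K₂ q₁ q₂ : ℝ}
    (h : (a ≤ α n ∧ α n ≤ b) ∧ r ≤ ρ n ∧ ρ n ≤ s) (k₁ k₂ : ℕ) (t₁ t₂ : ℝ) (ht₁ : 0 ≤ t₁)
    (ht₂ : 0 ≤ t₂) (h₁ : 2 ^ k₁ * (1 + t₁) ≤ stepP a r * (1 - t₁))
    (h₂ : stepP b s * (1 - t₂) ≤ 2 ^ k₂ * (1 + t₂))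
    (hq₁ : q₁ ≤ 2 * ∑ i ∈ Finset.range 14, t₁ ^ (2 * i + 1) / (2 * i + 1))
    (hq₂ : 2 * (∑ i ∈ Finset.range 14, t₂ ^ (2 * i + 1) / (2 * i + 1)) +
      2 * (t₂ ^ 29 / (1 - t₂ ^ 2)) ≤ q₂)
    (ht₁' : t₁ < 1) (ht₂' : t₂ < 1) (ha : 0 ≤ a) (hr : 0 ≤ r) (hK₁ : K₁ = k₁) (hK₂ : K₂ = k₂) :
    K₁ * Real.log 2 + q₁ ≤ Real.log (P n) ∧ Real.log (P n) ≤ K₂ * Real.log 2 + q₂ := by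
  obtain ⟨⟨h₃, h₄⟩, h₅, h₆⟩ := h
  have hl := stepP_mono ha hr h₃ h₅
  have hu := stepP_mono (α_pos n).le (ρ_pos n).le h₄ h₆
  rw [← P_eq] at hl hu
  refine ⟨two_pow_mul_le_log k₁ hK₁ ht₁ ht₁' (h₁.trans ?_) hq₁,
    log_le_two_pow_mul k₂ hK₂ ht₂ ht₂' (P_pos n) (le_trans ?_ h₂) hq₂⟩
  · exact mul_le_mul_of_nonneg_right hl (by linarith)
  · exact mul_le_mul_of_nonneg_right hu (by linarith)

theorem log_Q_bounds {n : ℕ} {a b r s K₁ K₂ q₁ q₂ : ℝ}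
    (h : (a ≤ α n ∧ α n ≤ b) ∧ r ≤ ρ n ∧ ρ n ≤ s) (k₁ k₂ : ℕ) (t₁ t₂ : ℝ) (ht₁ : 0 ≤ t₁)
    (ht₂ : 0 ≤ t₂) (h₁ : 2 ^ k₁ * (1 + t₁) ≤ stepQ a r * (1 - t₁))
    (h₂ : stepQ b s * (1 - t₂) ≤ 2 ^ k₂ * (1 + t₂))
    (hq₁ : q₁ ≤ 2 * ∑ i ∈ Finset.range 14, t₁ ^ (2 * i + 1) / (2 * i + 1))
    (hq₂ : 2 * (∑ i ∈ Finset.range 14, t₂ ^ (2 * i + 1) / (2 * i + 1)) +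
      2 * (t₂ ^ 29 / (1 - t₂ ^ 2)) ≤ q₂)
    (ht₁' : t₁ < 1) (ht₂' : t₂ < 1) (ha : 0 ≤ a) (hr : 0 ≤ r) (hK₁ : K₁ = k₁) (hK₂ : K₂ = k₂) :
    K₁ * Real.log 2 + q₁ ≤ Real.log (Q n) ∧ Real.log (Q n) ≤ K₂ * Real.log 2 + q₂ := by
  obtain ⟨⟨h₃, h₄⟩, h₅, h₆⟩ := h
  have hl := stepQ_mono ha hr h₃ h₅
  have hu := stepQ_mono (α_pos n).le (ρ_pos n).le h₄ h₆
  rw [← Q_eq] at hl hu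
  refine ⟨two_pow_mul_le_log k₁ hK₁ ht₁ ht₁' (h₁.trans ?_) hq₁,
    log_le_two_pow_mul k₂ hK₂ ht₂ ht₂' (Q_pos n) (le_trans ?_ h₂) hq₂⟩
  · exact mul_le_mul_of_nonneg_right hl (by linarith)
  · exact mul_le_mul_of_nonneg_right hu (by linarith)

theorem bounds_zero : (4 ≤ α 0 ∧ α 0 ≤ 4) ∧ (4 : ℝ) ≤ ρ 0 ∧ ρ 0 ≤ 4 := by
  simp [α_zero, ρ_zero]

/-- Interval arithmetic: the endpoints are rounded outwards to 18 decimals, so that each step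
reduces to inequalities between rational numbers. -/
theorem bounds_one : (2.282001299545159194 ≤ α 1 ∧ α 1 ≤ 2.282001299545159195) ∧
    (3.131635311656514761 : ℝ) ≤ ρ 1 ∧ ρ 1 ≤ 3.131635311656514762 := by
  refine bounds_succ (n := 0) ?_ ?_ bounds_zero.1 bounds_zero.2 ?_ ?_ ?_ ?_ ?_ ?_ <;>
    norm_num [stepP, stepQ, stepR]

theorem bounds_two : (1.272192827329446666 ≤ α 2 ∧ α 2 ≤ 1.272192827329446668) ∧
    (3.08848266555709074 : ℝ) ≤ ρ 2 ∧ ρ 2 ≤ 3.088482665557090747 := by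
  refine bounds_succ (n := 1) ?_ ?_ bounds_one.1 bounds_one.2 ?_ ?_ ?_ ?_ ?_ ?_ <;>
    norm_num [stepP, stepQ, stepR]

theorem bounds_three : (0.660858801678112012 ≤ α 3 ∧ α 3 ≤ 0.660858801678112016) ∧
    (3.060701216725028396 : ℝ) ≤ ρ 3 ∧ ρ 3 ≤ 3.06070121672502842 := by
  refine bounds_succ (n := 2) ?_ ?_ bounds_two.1 bounds_two.2 ?_ ?_ ?_ ?_ ?_ ?_ <;>
    norm_num [stepP, stepQ, stepR]

theorem bounds_four : (0.326587785819904324 ≤ α 4 ∧ α 4 ≤ 0.32658778581990433) ∧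
    (3.035957569572038041 : ℝ) ≤ ρ 4 ∧ ρ 4 ≤ 3.035957569572038114 := by
  refine bounds_succ (n := 3) ?_ ?_ bounds_three.1 bounds_three.2 ?_ ?_ ?_ ?_ ?_ ?_ <;>
    norm_num [stepP, stepQ, stepR]

theorem bounds_five : (0.156819709467333984 ≤ α 5 ∧ α 5 ≤ 0.156819709467333992) ∧
    (3.019109848589173811 : ℝ) ≤ ρ 5 ∧ ρ 5 ≤ 3.019109848589174016 := by
  refine bounds_succ (n := 4) ?_ ?_ bounds_four.1 bounds_four.2 ?_ ?_ ?_ ?_ ?_ ?_ <;>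
    norm_num [stepP, stepQ, stepR]

theorem bounds_six : (0.074192831376151385 ≤ α 6 ∧ α 6 ≤ 0.074192831376151395) ∧
    (3.009526215680516403 : ℝ) ≤ ρ 6 ∧ ρ 6 ≤ 3.009526215680516953 := by
  refine bounds_succ (n := 5) ?_ ?_ bounds_five.1 bounds_five.2 ?_ ?_ ?_ ?_ ?_ ?_ <;>
    norm_num [stepP, stepQ, stepR]

theorem bounds_seven : (0.03484844154157251 ≤ α 7 ∧ α 7 ≤ 0.034848441541572521) ∧
    (3.004590838153846248 : ℝ) ≤ ρ 7 ∧ ρ 7 ≤ 3.004590838153847692 := by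
  refine bounds_succ (n := 6) ?_ ?_ bounds_six.1 bounds_six.2 ?_ ?_ ?_ ?_ ?_ ?_ <;>
    norm_num [stepP, stepQ, stepR]

theorem bounds_eight : (0.016312149435694539 ≤ α 8 ∧ α 8 ≤ 0.016312149435694552) ∧
    (3.002175491434633441 : ℝ) ≤ ρ 8 ∧ ρ 8 ≤ 3.002175491434637186 := by
  refine bounds_succ (n := 7) ?_ ?_ bounds_seven.1 bounds_seven.2 ?_ ?_ ?_ ?_ ?_ ?_ <;>
    norm_num [stepP, stepQ, stepR]

theorem bounds_nine : (0.007623178213730389 ≤ α 9 ∧ α 9 ≤ 0.007623178213730405) ∧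
    (3.001022595898918636 : ℝ) ≤ ρ 9 ∧ ρ 9 ≤ 3.001022595898928307 := by
  refine bounds_succ (n := 8) ?_ ?_ bounds_eight.1 bounds_eight.2 ?_ ?_ ?_ ?_ ?_ ?_ <;>
    norm_num [stepP, stepQ, stepR]

theorem log_two_bounds : 0.693147180559944 ≤ Real.log 2 ∧ Real.log 2 ≤ 0.693147180559977 := by
  -- With k = 0 the term in ln 2 vanishes on the left, and t = 1/3 gives (1 + t) / (1 - t) = 2.
  have h := two_pow_mul_le_log (x := 2) (t := 1 / 3) (q := 0.693147180559944) 0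
    (K := 0) (by norm_num) (by norm_num) (by norm_num) (by norm_num) (by norm_num [Finset.sum_range_succ])
  have h' := log_le_two_pow_mul (x := 2) (t := 1 / 3) (q := 0.693147180559977) 0
    (K := 0) (by norm_num) (by norm_num)
    (by norm_num) (by norm_num) (by norm_num) (by norm_num [Finset.sum_range_succ])
  constructor <;> linarith

theorem log_P_zero_bounds : 9 * Real.log 2 + 0.539321968595608 ≤ Real.log (P 0) ∧
    Real.log (P 0) ≤ 9 * Real.log 2 + 0.53932196859561 :=
  log_P_bounds bounds_zero 9 9 0.2633093525179856 0.2633093525179857 (by norm_num) (by norm_num)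
    (by norm_num [stepP]) (by norm_num [stepP])
    (by norm_num [Finset.sum_range_succ]) (by norm_num [Finset.sum_range_succ])
    (by norm_num) (by norm_num) (by norm_num) (by norm_num) (by norm_num) (by norm_num)

theorem log_Q_zero_bounds : 10 * Real.log 2 + 0.407416328239426 ≤ Real.log (Q 0) ∧
    Real.log (Q 0) ≤ 10 * Real.log 2 + 0.407416328239427 :=
  log_Q_bounds bounds_zero 10 10 0.2009364026531408 0.2009364026531409 (by norm_num) (by norm_num)
    (by norm_num [stepQ]) (by norm_num [stepQ])
    (by norm_num [Finset.sum_range_succ]) (by norm_num [Finset.sum_range_succ])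
    (by norm_num) (by norm_num) (by norm_num) (by norm_num) (by norm_num) (by norm_num)

theorem log_P_one_bounds : 8 * Real.log 2 + 0.644730631631376 ≤ Real.log (P 1) ∧
    Real.log (P 1) ≤ 8 * Real.log 2 + 0.644730631631382 :=
  log_P_bounds bounds_one 8 8 0.3116440841380466 0.3116440841380467 (by norm_num) (by norm_num)
    (by norm_num [stepP]) (by norm_num [stepP])
    (by norm_num [Finset.sum_range_succ]) (by norm_num [Finset.sum_range_succ])
    (by norm_num) (by norm_num) (by norm_num) (by norm_num) (by norm_num) (by norm_num)

theorem log_Q_one_bounds : 9 * Real.log 2 + 0.535894224746351 ≤ Real.log (Q 1) ∧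
    Real.log (Q 1) ≤ 9 * Real.log 2 + 0.535894224746353 :=
  log_Q_bounds bounds_one 9 9 0.2617135878729377 0.2617135878729378 (by norm_num) (by norm_num)
    (by norm_num [stepQ]) (by norm_num [stepQ])
    (by norm_num [Finset.sum_range_succ]) (by norm_num [Finset.sum_range_succ])
    (by norm_num) (by norm_num) (by norm_num) (by norm_num) (by norm_num) (by norm_num)

theorem log_P_two_bounds : 8 * Real.log 2 + 0.268795748425721 ≤ Real.log (P 2) ∧
    Real.log (P 2) ≤ 8 * Real.log 2 + 0.268795748425722 :=
  log_P_bounds bounds_two 8 8 0.1335944782130771 0.1335944782130772 (by norm_num) (by norm_num)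
    (by norm_num [stepP]) (by norm_num [stepP])
    (by norm_num [Finset.sum_range_succ]) (by norm_num [Finset.sum_range_succ])
    (by norm_num) (by norm_num) (by norm_num) (by norm_num) (by norm_num) (by norm_num)

theorem log_Q_two_bounds : 9 * Real.log 2 + 0.230605690250971 ≤ Real.log (Q 2) ∧
    Real.log (Q 2) ≤ 9 * Real.log 2 + 0.230605690250973 :=
  log_Q_bounds bounds_two 9 9 0.1147945738727486 0.1147945738727487 (by norm_num) (by norm_num)
    (by norm_num [stepQ]) (by norm_num [stepQ])
    (by norm_num [Finset.sum_range_succ]) (by norm_num [Finset.sum_range_succ])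
    (by norm_num) (by norm_num) (by norm_num) (by norm_num) (by norm_num) (by norm_num)

theorem log_P_three_bounds : 8 * Real.log 2 + 0.021437769220268 ≤ Real.log (P 3) ∧
    Real.log (P 3) ≤ 8 * Real.log 2 + 0.02143776922027 :=
  log_P_bounds bounds_three 8 8 0.010718474115416 0.0107184741154161 (by norm_num) (by norm_num)
    (by norm_num [stepP]) (by norm_num [stepP])
    (by norm_num [Finset.sum_range_succ]) (by norm_num [Finset.sum_range_succ])
    (by norm_num) (by norm_num) (by norm_num) (by norm_num) (by norm_num) (by norm_num)

theorem log_Q_three_bounds : 9 * Real.log 2 + 0.033132010640901 ≤ Real.log (Q 3) ∧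
    Real.log (Q 3) ≤ 9 * Real.log 2 + 0.033132010640902 :=
  log_Q_bounds bounds_three 9 9 0.0165644900698543 0.0165644900698544 (by norm_num) (by norm_num)
    (by norm_num [stepQ]) (by norm_num [stepQ])
    (by norm_num [Finset.sum_range_succ]) (by norm_num [Finset.sum_range_succ])
    (by norm_num) (by norm_num) (by norm_num) (by norm_num) (by norm_num) (by norm_num)

theorem log_P_four_bounds : 7 * Real.log 2 + 0.571731078080984 ≤ Real.log (P 4) ∧
    Real.log (P 4) ≤ 7 * Real.log 2 + 0.571731078080986 :=
  log_P_bounds bounds_four 7 7 0.2783250327129738 0.2783250327129739 (by norm_num) (by norm_num)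
    (by norm_num [stepP]) (by norm_num [stepP])
    (by norm_num [Finset.sum_range_succ]) (by norm_num [Finset.sum_range_succ])
    (by norm_num) (by norm_num) (by norm_num) (by norm_num) (by norm_num) (by norm_num)

theorem log_Q_four_bounds : 8 * Real.log 2 + 0.612185881228143 ≤ Real.log (Q 4) ∧
    Real.log (Q 4) ≤ 8 * Real.log 2 + 0.612185881228145 :=
  log_Q_bounds bounds_four 8 8 0.2968785394928654 0.2968785394928655 (by norm_num) (by norm_num)
    (by norm_num [stepQ]) (by norm_num [stepQ])
    (by norm_num [Finset.sum_range_succ]) (by norm_num [Finset.sum_range_succ])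
    (by norm_num) (by norm_num) (by norm_num) (by norm_num) (by norm_num) (by norm_num)

theorem log_P_five_bounds : 7 * Real.log 2 + 0.496832987933728 ≤ Real.log (P 5) ∧
    Real.log (P 5) ≤ 7 * Real.log 2 + 0.496832987933729 :=
  log_P_bounds bounds_five 7 7 0.2434295669478602 0.2434295669478603 (by norm_num) (by norm_num)
    (by norm_num [stepP]) (by norm_num [stepP])
    (by norm_num [Finset.sum_range_succ]) (by norm_num [Finset.sum_range_succ])
    (by norm_num) (by norm_num) (by norm_num) (by norm_num) (by norm_num) (by norm_num)

theorem log_Q_five_bounds : 8 * Real.log 2 + 0.55211507219942 ≤ Real.log (Q 5) ∧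
    Real.log (Q 5) ≤ 8 * Real.log 2 + 0.552115072199422 :=
  log_Q_bounds bounds_five 8 8 0.269252329130536 0.2692523291305362 (by norm_num) (by norm_num)
    (by norm_num [stepQ]) (by norm_num [stepQ])
    (by norm_num [Finset.sum_range_succ]) (by norm_num [Finset.sum_range_succ])
    (by norm_num) (by norm_num) (by norm_num) (by norm_num) (by norm_num) (by norm_num)

theorem log_P_six_bounds : 7 * Real.log 2 + 0.459752760276955 ≤ Real.log (P 6) ∧
    Real.log (P 6) ≤ 7 * Real.log 2 + 0.459752760276956 :=
  log_P_bounds bounds_six 7 7 0.2259110447323498 0.22591104473235 (by norm_num) (by norm_num)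
    (by norm_num [stepP]) (by norm_num [stepP])
    (by norm_num [Finset.sum_range_succ]) (by norm_num [Finset.sum_range_succ])
    (by norm_num) (by norm_num) (by norm_num) (by norm_num) (by norm_num) (by norm_num)

theorem log_Q_six_bounds : 8 * Real.log 2 + 0.522264695871888 ≤ Real.log (Q 6) ∧
    Real.log (Q 6) ≤ 8 * Real.log 2 + 0.52226469587189 :=
  log_Q_bounds bounds_six 8 8 0.2553543505637061 0.2553543505637063 (by norm_num) (by norm_num)
    (by norm_num [stepQ]) (by norm_num [stepQ])
    (by norm_num [Finset.sum_range_succ]) (by norm_num [Finset.sum_range_succ])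
    (by norm_num) (by norm_num) (by norm_num) (by norm_num) (by norm_num) (by norm_num)

theorem log_P_seven_bounds : 7 * Real.log 2 + 0.441943623265075 ≤ Real.log (P 7) ∧
    Real.log (P 7) ≤ 7 * Real.log 2 + 0.441943623265076 :=
  log_P_bounds bounds_seven 7 7 0.2174441193794941 0.2174441193794943 (by norm_num) (by norm_num)
    (by norm_num [stepP]) (by norm_num [stepP])
    (by norm_num [Finset.sum_range_succ]) (by norm_num [Finset.sum_range_succ])
    (by norm_num) (by norm_num) (by norm_num) (by norm_num) (by norm_num) (by norm_num)

theorem log_Q_seven_bounds : 8 * Real.log 2 + 0.507894665555228 ≤ Real.log (Q 7) ∧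
    Real.log (Q 7) ≤ 8 * Real.log 2 + 0.507894665555229 :=
  log_Q_bounds bounds_seven 8 8 0.2486256107879294 0.2486256107879297 (by norm_num) (by norm_num)
    (by norm_num [stepQ]) (by norm_num [stepQ])
    (by norm_num [Finset.sum_range_succ]) (by norm_num [Finset.sum_range_succ])
    (by norm_num) (by norm_num) (by norm_num) (by norm_num) (by norm_num) (by norm_num)

theorem log_P_eight_bounds : 7 * Real.log 2 + 0.433518013409413 ≤ Real.log (P 8) ∧
    Real.log (P 8) ≤ 7 * Real.log 2 + 0.433518013409415 :=
  log_P_bounds bounds_eight 7 7 0.213426847808314 0.2134268478083143 (by norm_num) (by norm_num)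
    (by norm_num [stepP]) (by norm_num [stepP])
    (by norm_num [Finset.sum_range_succ]) (by norm_num [Finset.sum_range_succ])
    (by norm_num) (by norm_num) (by norm_num) (by norm_num) (by norm_num) (by norm_num)

theorem log_Q_eight_bounds : 8 * Real.log 2 + 0.501087656011897 ≤ Real.log (Q 8) ∧
    Real.log (Q 8) ≤ 8 * Real.log 2 + 0.501087656011899 :=
  log_Q_bounds bounds_eight 8 8 0.2454298006737479 0.2454298006737484 (by norm_num) (by norm_num)
    (by norm_num [stepQ]) (by norm_num [stepQ])
    (by norm_num [Finset.sum_range_succ]) (by norm_num [Finset.sum_range_succ])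
    (by norm_num) (by norm_num) (by norm_num) (by norm_num) (by norm_num) (by norm_num)

theorem log_P_nine_bounds : 7 * Real.log 2 + 0.429560584891333 ≤ Real.log (P 9) ∧
    Real.log (P 9) ≤ 7 * Real.log 2 + 0.429560584891335 :=
  log_P_bounds bounds_nine 7 7 0.2115374705623219 0.2115374705623224 (by norm_num) (by norm_num)
    (by norm_num [stepP]) (by norm_num [stepP])
    (by norm_num [Finset.sum_range_succ]) (by norm_num [Finset.sum_range_succ])
    (by norm_num) (by norm_num) (by norm_num) (by norm_num) (by norm_num) (by norm_num)

theorem log_Q_nine_bounds : 8 * Real.log 2 + 0.497888484418347 ≤ Real.log (Q 9) ∧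
    Real.log (Q 9) ≤ 8 * Real.log 2 + 0.497888484418351 :=
  log_Q_bounds bounds_nine 8 8 0.2439259780892789 0.24392597808928 (by norm_num) (by norm_num)
    (by norm_num [stepQ]) (by norm_num [stepQ])
    (by norm_num [Finset.sum_range_succ]) (by norm_num [Finset.sum_range_succ])
    (by norm_num) (by norm_num) (by norm_num) (by norm_num) (by norm_num) (by norm_num)

theorem log_196_lower : 7 * Real.log 2 + 0.426084395310899 ≤ Real.log 196 :=
  two_pow_mul_le_log (t := 0.2098765432098765) 7 (by norm_num) (by norm_num) (by norm_num) (by norm_num)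
    (by norm_num [Finset.sum_range_succ])

theorem log_420_lower : 8 * Real.log 2 + 0.495077266797851 ≤ Real.log 420 :=
  two_pow_mul_le_log (t := 0.2426035502958579) 8 (by norm_num) (by norm_num) (by norm_num) (by norm_num)
    (by norm_num [Finset.sum_range_succ])

end SG23

/-! ### Monotone bounds and the growth constant -/

namespace SG23

open Filter Topology

/-- The induction starts at 2 because the invariant fails at 1: α 1 ≈ 2.28 exceeds 15 (ρ 1 - 3) ≈
1.97. The bound α ≤ 13/10 also holds only from 2 on. -/
theorem ρ_bounds (n : ℕ) : (3 ≤ ρ (n + 2) ∧ ρ (n + 2) ≤ 4) ∧ α (n + 2) ≤ 15 * (ρ (n + 2) - 3) := by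
  induction n with
  | zero =>
    have h := bounds_two
    refine ⟨⟨?_, ?_⟩, ?_⟩ <;> rw [zero_add] <;> linarith [h.1.2, h.2.1, h.2.2]
  | succ n ih =>
    obtain ⟨⟨h₁, h₂⟩, h₃⟩ := ih
    have hα : α (n + 2) ≤ 13 / 10 := by
      have := α_antitone (show 2 ≤ n + 2 by omega)
      linarith [bounds_two.1.2]
    exact ⟨⟨three_le_ρ_succ h₁ h₂, (ρ_succ_le h₁ h₃).trans h₂⟩, α_succ_le_mul h₁ h₂ hα⟩

theorem three_le_ρ : ∀ n, 3 ≤ ρ n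
  | 0 => by linarith [bounds_zero.2.1]
  | 1 => by linarith [bounds_one.2.1]
  | n + 2 => (ρ_bounds n).1.1

theorem ρ_le_four : ∀ n, ρ n ≤ 4
  | 0 => by linarith [bounds_zero.2.2]
  | 1 => by linarith [bounds_one.2.2]
  | n + 2 => (ρ_bounds n).1.2

theorem ρ_succ_succ_le : ∀ n, ρ (n + 2) ≤ ρ (n + 1)
  | 0 => by
    rw [zero_add, zero_add]
    linarith [bounds_one.2.1, bounds_two.2.2]
  | n + 1 => ρ_succ_le (ρ_bounds n).1.1 (ρ_bounds n).2

/-- The increment of `2 * log f + 3 * log g`, up to a factor. -/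
noncomputable def increment (n : ℕ) : ℝ := 2 * Real.log (P n) + 3 * Real.log (Q n)

/-- The limit of `increment`. -/
noncomputable def limitIncrement : ℝ := 2 * Real.log 196 + 3 * Real.log 420

/-- The numbers 196 and 420 are the values of P and Q at α = 0, ρ = 3. Only this inequality is used,
never the convergence of α and ρ. -/
theorem limitIncrement_le (n : ℕ) : limitIncrement ≤ increment n := by
  have h₁ : 196 ≤ P n := by
    have := stepP_mono le_rfl (by norm_num) (α_pos n).le (three_le_ρ n)
    rw [← P_eq] at this
    exact le_trans (by norm_num [stepP]) this
  have h₂ : 420 ≤ Q n := by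
    have := stepQ_mono le_rfl (by norm_num) (α_pos n).le (three_le_ρ n)
    rw [← Q_eq] at this
    exact le_trans (by norm_num [stepQ]) this
  unfold limitIncrement increment
  gcongr

theorem increment_succ_le (n : ℕ) : increment (n + 2) ≤ increment (n + 1) := by
  have h₁ : P (n + 2) ≤ P (n + 1) := by
    rw [P_eq, P_eq]
    exact stepP_mono (α_pos _).le (ρ_pos _).le (α_succ_le _) (ρ_succ_succ_le n)
  have h₂ : Q (n + 2) ≤ Q (n + 1) := by
    rw [Q_eq, Q_eq]
    exact stepQ_mono (α_pos _).le (ρ_pos _).le (α_succ_le _) (ρ_succ_succ_le n)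
  have := P_pos (n + 2)
  have := Q_pos (n + 2)
  unfold increment
  gcongr

noncomputable def weight (n : ℕ) : ℝ :=
  1 / (7 * 6 ^ n) * (2 * Real.log (f n) + 3 * Real.log (g n))

/-- The coefficients 2, 3 satisfy 2 · 3 + 3 · 2 = 6 · 2 and 2 · 3 + 3 · 4 = 6 · 3, so the exponents
of f and g are multiplied by 6 exactly. -/
theorem weight_succ (n : ℕ) : weight (n + 1) = weight n + increment n / (42 * 6 ^ n) := by
  have hf := (f_pos n).ne'
  have hg := (g_pos n).ne'
  have hP := (P_pos n).ne'
  have hQ := (Q_pos n).ne'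
  rw [weight, weight, increment, f_succ_eq, g_succ_eq, Real.log_mul (by positivity) hP,
    Real.log_mul (by positivity) (by positivity), Real.log_mul (by positivity) hQ,
    Real.log_mul (by positivity) (by positivity), Real.log_pow, Real.log_pow, Real.log_pow,
    Real.log_pow, pow_succ]
  push_cast
  field_simp
  ring

noncomputable def lower (n : ℕ) : ℝ := weight n + 1 / (35 * 6 ^ n) * limitIncrement

noncomputable def upper (n : ℕ) : ℝ := weight n + 1 / (35 * 6 ^ n) * increment n

/-- The factor 1/35 is the geometric sum of 1/(42 · 6 ^ k), so `lower` replaces all the remaining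
increments by their lower bound; each step replaces one of them by its true value. -/
theorem lower_monotone : Monotone lower := by
  refine monotone_nat_of_le_succ fun n => ?_
  have h : lower (n + 1) = lower n + (increment n - limitIncrement) / (42 * 6 ^ n) := by
    rw [lower, lower, weight_succ, pow_succ]
    field_simp
    ring
  rw [h, le_add_iff_nonneg_right]
  exact div_nonneg (sub_nonneg.2 (limitIncrement_le n)) (by positivity)

/-- Here the remaining increments are replaced by the current one, and 1/35 - 1/42 = 1/210. The
index is shifted since the decrease is established only from 1 on. -/
theorem upper_antitone : Antitone fun n => upper (n + 1) := by
  refine antitone_nat_of_succ_le fun n => ?_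
  have h : upper (n + 1 + 1) =
      upper (n + 1) - (increment (n + 1) - increment (n + 2)) / (210 * 6 ^ (n + 1)) := by
    rw [upper, upper, weight_succ, pow_succ 6 (n + 1)]
    field_simp
    ring
  rw [h, sub_le_self_iff]
  exact div_nonneg (sub_nonneg.2 (increment_succ_le n)) (by positivity)

theorem lower_le_upper (n : ℕ) : lower n ≤ upper n := by
  unfold lower upper
  have := limitIncrement_le n
  gcongr

theorem lower_le_upper_of_one_le (n : ℕ) {m : ℕ} (hm : 1 ≤ m) : lower n ≤ upper m := by
  obtain ⟨k, rfl⟩ := Nat.exists_eq_add_of_le' hm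
  calc lower n ≤ lower (max n k + 1) := lower_monotone (by omega)
    _ ≤ upper (max n k + 1) := lower_le_upper _
    _ ≤ upper (k + 1) := upper_antitone (le_max_right n k)

theorem tendsto_inv_six_pow : Tendsto (fun n : ℕ => ((6 : ℝ) ^ n)⁻¹) atTop (𝓝 0) :=
  (tendsto_pow_atTop_atTop_of_one_lt (by norm_num : (1 : ℝ) < 6)).inv_tendsto_atTop

theorem neg_mul_log_le_log_α (n : ℕ) : -(n * Real.log 5) ≤ Real.log (α n) := by
  induction n with
  | zero =>
    rw [α_zero, Nat.cast_zero, zero_mul, neg_zero]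
    exact Real.log_nonneg (by norm_num)
  | succ n ih =>
    have h : α n / 5 ≤ α (n + 1) := by
      rw [α_succ, le_div_iff₀ (Q_pos n), P_eq, Q_eq]
      have := mul_le_mul_of_nonneg_left
        (stepQ_le_stepP (α_pos n).le (ρ_pos n).le (ρ_le_four n)) (α_pos n).le
      linarith
    have h' := Real.log_le_log (by linarith [α_pos n]) h
    rw [Real.log_div (α_pos n).ne' (by norm_num)] at h'
    push_cast
    linarith

theorem log_α_le (n : ℕ) : Real.log (α n) ≤ Real.log 4 :=
  Real.log_le_log (α_pos n) (α_zero ▸ α_antitone (Nat.zero_le n))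

theorem tendsto_log_α : Tendsto (fun n => Real.log (α n) * ((6 : ℝ) ^ n)⁻¹) atTop (𝓝 0) := by
  have h₁ : Tendsto (fun n : ℕ => -(n * Real.log 5) * ((6 : ℝ) ^ n)⁻¹) atTop (𝓝 0) := by
    have := (tendsto_self_mul_const_pow_of_lt_one (r := (6 : ℝ)⁻¹) (by norm_num)
      (by norm_num)).const_mul (-Real.log 5)
    rw [mul_zero] at this
    refine this.congr fun n => ?_
    rw [inv_pow]
    ring
  have h₂ : Tendsto (fun n : ℕ => Real.log 4 * ((6 : ℝ) ^ n)⁻¹) atTop (𝓝 0) := by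
    simpa using tendsto_inv_six_pow.const_mul (Real.log 4)
  refine tendsto_of_tendsto_of_tendsto_of_le_of_le h₁ h₂ (fun n => ?_) fun n => ?_
  · exact mul_le_mul_of_nonneg_right (neg_mul_log_le_log_α n) (by positivity)
  · exact mul_le_mul_of_nonneg_right (log_α_le n) (by positivity)

/-- This rests on 5 ln f = (2 ln f + 3 ln g) + 3 ln α and 5 v(n) = 7 · 6 ^ n + 8. -/
theorem log_f_div_card (n : ℕ) : Real.log (f n) / Fintype.card (vertices n) =
    (weight n + 3 / 7 * (Real.log (α n) * ((6 : ℝ) ^ n)⁻¹)) /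
      (1 + 8 / 7 * ((6 : ℝ) ^ n)⁻¹) := by
  have hv : (Fintype.card (vertices n) : ℝ) = (7 * 6 ^ n + 8) / 5 := by
    have : (5 * Fintype.card (vertices n) : ℝ) = 7 * 6 ^ n + 8 := by
      exact_mod_cast card_vertices n
    linarith
  rw [hv, weight, α, Real.log_div (f_pos n).ne' (g_pos n).ne']
  field_simp
  ring

theorem tendsto_log_f {z : ℝ} (h : Tendsto weight atTop (𝓝 z)) :
    Tendsto (fun n => Real.log (f n) / Fintype.card (vertices n)) atTop (𝓝 z) := by
  have h₁ : Tendsto (fun n : ℕ => 1 + 8 / 7 * ((6 : ℝ) ^ n)⁻¹) atTop (𝓝 1) := by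
    simpa using (tendsto_inv_six_pow.const_mul (8 / 7)).const_add 1
  have h₂ := (h.add (tendsto_log_α.const_mul (3 / 7))).div h₁ one_ne_zero
  rw [mul_zero, add_zero, div_one] at h₂
  exact h₂.congr fun n => (log_f_div_card n).symm

/-- The limit is the supremum of `lower`, from which `weight` differs by a multiple of 6 ^ (-n). -/
theorem exists_tendsto_weight :
    ∃ z, Tendsto weight atTop (𝓝 z) ∧ (∀ n, lower n ≤ z) ∧ ∀ m, 1 ≤ m → z ≤ upper m := by
  have hbdd : BddAbove (Set.range lower) :=
    ⟨upper 1, Set.forall_mem_range.2 fun n => lower_le_upper_of_one_le n le_rfl⟩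
  refine ⟨⨆ n, lower n, ?_, le_ciSup hbdd, fun m hm =>
    ciSup_le fun n => lower_le_upper_of_one_le n hm⟩
  have h := (tendsto_atTop_ciSup lower_monotone hbdd).sub
    (tendsto_inv_six_pow.mul_const (limitIncrement / 35))
  rw [zero_mul, sub_zero] at h
  refine h.congr fun n => ?_
  rw [lower]
  field_simp
  ring

theorem weight_zero : weight 0 = 4 / 7 * Real.log 2 := by
  have h : Real.log 4 = 2 * Real.log 2 := by
    rw [show (4 : ℝ) = 2 ^ 2 by norm_num, Real.log_pow]
    norm_num
  rw [weight, f_zero, g_zero]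
  norm_num [h]
  ring

/-- Unfolding nine steps leaves a combination of logarithms with positive coefficients, so one-sided
bounds suffice. At 9 the gap between `lower` and `upper` is below 5 · 10⁻¹¹, small enough for ten
decimals. -/
theorem le_lower_nine : 1.3972789680 ≤ lower 9 := by
  simp only [lower, weight_succ, weight_zero, increment, limitIncrement]
  norm_num only
  linarith [log_two_bounds.1, log_P_zero_bounds.1, log_Q_zero_bounds.1, log_P_one_bounds.1,
    log_Q_one_bounds.1, log_P_two_bounds.1, log_Q_two_bounds.1, log_P_three_bounds.1,
    log_Q_three_bounds.1, log_P_four_bounds.1, log_Q_four_bounds.1, log_P_five_bounds.1,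
    log_Q_five_bounds.1, log_P_six_bounds.1, log_Q_six_bounds.1, log_P_seven_bounds.1,
    log_Q_seven_bounds.1, log_P_eight_bounds.1, log_Q_eight_bounds.1, log_196_lower,
    log_420_lower]

theorem upper_nine_lt : upper 9 < 1.3972789681 := by
  simp only [upper, weight_succ, weight_zero, increment]
  norm_num only
  linarith [log_two_bounds.2, log_P_zero_bounds.2, log_Q_zero_bounds.2, log_P_one_bounds.2,
    log_Q_one_bounds.2, log_P_two_bounds.2, log_Q_two_bounds.2, log_P_three_bounds.2,
    log_Q_three_bounds.2, log_P_four_bounds.2, log_Q_four_bounds.2, log_P_five_bounds.2,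
    log_Q_five_bounds.2, log_P_six_bounds.2, log_Q_six_bounds.2, log_P_seven_bounds.2,
    log_Q_seven_bounds.2, log_P_eight_bounds.2, log_Q_eight_bounds.2, log_P_nine_bounds.2,
    log_Q_nine_bounds.2]

end SG23

theorem proposition2 :
    ∃ z : ℝ,
      Filter.Tendsto
        (fun n : ℕ => Real.log (numConnectedSpanningSubgraphs (SG23.graph n) : ℝ) /
          (Fintype.card (SG23.vertices n) : ℝ))
        Filter.atTop (nhds z) ∧
      (1.3972789680 : ℝ) ≤ z ∧ z < (1.3972789681 : ℝ) ∧
      ∀ m : ℕ, 1 ≤ m →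
        (1 / (7 * 6 ^ m) * (2 * Real.log (SG23.f m : ℝ) + 3 * Real.log (SG23.g m : ℝ))
            + 1 / (35 * 6 ^ m) * (2 * Real.log 196 + 3 * Real.log 420) ≤ z) ∧
        (z ≤ 1 / (7 * 6 ^ m) * (2 * Real.log (SG23.f m : ℝ) + 3 * Real.log (SG23.g m : ℝ))
            + 1 / (35 * 6 ^ m) * (2 * Real.log (SG23.P m) + 3 * Real.log (SG23.Q m))) := by
  obtain ⟨z, hz, hl, hu⟩ := SG23.exists_tendsto_weight
  exact ⟨z, SG23.tendsto_log_f hz, SG23.le_lower_nine.trans (hl 9),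
    (hu 9 (by norm_num)).trans_lt SG23.upper_nine_lt, fun m hm => ⟨hl m, hu m hm⟩⟩
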